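/- Let $Q$ be a regular pentagon with a horizontal side, used as a billiard table. The (combinatorial) period of a periodic billiard trajectory that avoids the vertices is the least number $N\ge 1$ of bounces after which position and velocity repeat; the trajectory is rotationally symmetric if its path is invariant under the rotation of $Q$ by $2\pi/5$. Then every positive multiple of $10$ is the period of a rotationally symmetric periodic billiard trajectory in $Q$. Moreover, for $k\ge 2$ the period $10k$ is attained as follows. Let $\phi=\frac{1+\sqrt5}{2}$ and $$\sigma_0=\begin{pmatrix}1&\phi\\0&1\end{pmatrix},\quad \sigma_1=\begin{pmatrix}\phi&\phi\\1&\phi\end{pmatrix},\quad \sigma_2=\begin{pmatrix}\phi&1\\ \phi&\phi\end{pmatrix},\quad \sigma_3=\begin{pmatrix}1&0\\ \phi&1\end{pmatrix},\quad P=\begin{pmatrix}1&\cos(\pi/5)\\0&\sin(\pi/5)\end{pmatrix}.$$ The direction with tree word $k_1k_2\cdots k_m$, $k_i\in\{0,1,2,3\}$, is the direction of the vector $P\,\sigma_{k_m}\cdots\sigma_{k_1}\binom10$. The double pentagon is the translation surface obtained from $Q$ and its reflected copy $-Q$ by gluing each side of $Q$ by a translation to the parallel side of $-Q$. Among its periodic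 trajectories in a given direction that avoid the vertices, those of minimal length are called short, and those whose length is $\phi$ times the minimal length are called long. A trajectory on the double pentagon is folded to a billiard trajectory in $Q$ by folding along each side that it crosses. Write $a0^m$ for the letter $a$ followed by $m$ zeros. 1. If $k\ge2$ and $k\not\equiv 3\pmod 5$, then short trajectories with tree word $1\,0^{k-2}$ exist, and every one of them folds to a rotationally symmetric billiard trajectory of period $10k$. 2. If $k\equiv 3\pmod{10}$, then long trajectories with tree word $1\,0^{(k-3)/2}$ exist, and every one of them folds to a rotationally symmetric billiard trajectory of period $10k$. 3. If $k\equiv 8\pmod{10}$, then short trajectories with tree word $2\,0^{(k-2)/2}$ exist, and every one of them folds to a rotationally symmetric billiard trajectory of period $10k$. -/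

import Mathlib

open scoped goldenRatio

namespace PentagonBilliards

noncomputable section

/-! ### The regular pentagon -/

/-- Multiplication by `zeta` is the rotation of the plane by `2π/5` about the origin. -/
def zeta : ℂ := Complex.exp (2 * Real.pi * Complex.I / 5)

/-- The outer unit normals of the five sides of the table; `normal 0` points straight down. -/
def normal (j : Fin 5) : ℂ := -Complex.I * zeta ^ (j : ℕ)

/-- The regular pentagon centred at the origin, with inradius `1` and with a horizontal bottom
side. -/
def pentagon : Set ℂ := {z | ∀ j, inner ℝ z (normal j) ≤ 1}

/-- The `j`-th side of the pentagon, without its end points (the vertices lie on two sides). -/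
def openSide (j : Fin 5) : Set ℂ :=
  {z | z ∈ pentagon ∧ ∀ i, inner ℝ z (normal i) = 1 ↔ i = j}

/-! ### Billiards in the pentagon -/

/-- A billiard trajectory in the pentagon that never hits a vertex. The `i`-th bounce happens at
`point i`, on side `side i`, and `dir i` is the velocity just after it. -/
structure BilliardTrajectory where
  point : ℕ → ℂ
  dir : ℕ → ℂ
  side : ℕ → Fin 5
  point_mem : ∀ i, point i ∈ openSide (side i)
  inward : ∀ i, inner ℝ (dir i) (normal (side i)) < 0
  advance : ∀ i, ∃ t : ℝ, 0 < t ∧ point (i + 1) = point i + t • dir i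
  reflect : ∀ i, dir (i + 1) =
    dir i - (2 * inner ℝ (dir i) (normal (side (i + 1)))) • normal (side (i + 1))

namespace BilliardTrajectory

/-- The state (position and velocity) repeats after `N` bounces. -/
def RepeatsAfter (B : BilliardTrajectory) (N : ℕ) : Prop :=
  0 < N ∧ ∀ i, B.point (i + N) = B.point i ∧ B.dir (i + N) = B.dir i

/-- `B` is periodic and its (combinatorial) period is `N`: this is the number of bounces after
which the motion repeats for the first time. -/
def HasPeriod (B : BilliardTrajectory) (N : ℕ) : Prop :=
  IsLeast {M | B.RepeatsAfter M} N

/-- The path in the table that is traced out by the trajectory. -/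
def trace (B : BilliardTrajectory) : Set ℂ :=
  ⋃ i, segment ℝ (B.point i) (B.point (i + 1))

/-- The path is mapped to itself by the rotation by `2π/5`. -/
def RotationallySymmetric (B : BilliardTrajectory) : Prop :=
  (fun z => zeta * z) '' B.trace = B.trace

end BilliardTrajectory

/-! ### The double pentagon surface

The surface consists of two sheets: sheet `1` is the table `pentagon`, sheet `-1` is its reflected
copy `-pentagon`. The side of sheet `ε` with outer normal `ε • normal j` is glued by a
translation to the parallel side of sheet `-ε`, whose outer normal is `-ε • normal j`. Both sides
have distance `1` from the respective centre, so that the gluing is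
`z ↦ z - 2 • ε • normal j`. -/

/-- The point `z` of sheet `ε` lies on the side `j` of that sheet, and is not a vertex. -/
def OnSide (ε : ℤˣ) (j : Fin 5) (z : ℂ) : Prop :=
  ((ε : ℤ) : ℝ) • z ∈ openSide j

/-- The outer normal of the side `j` of sheet `ε`. -/
def sheetNormal (ε : ℤˣ) (j : Fin 5) : ℂ := ((ε : ℤ) : ℝ) • normal j

/-- A trajectory of the linear flow with velocity `u` on the double pentagon that never hits a
vertex. The trajectory enters sheet `sheet i` at the point `entry i` of the side `side i`, crosses
that sheet in time `time i`, and leaves it through the side `side (i + 1)`. -/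
structure SurfaceTrajectory (u : ℂ) where
  sheet : ℕ → ℤˣ
  entry : ℕ → ℂ
  side : ℕ → Fin 5
  time : ℕ → ℝ
  entry_mem : ∀ i, OnSide (sheet i) (side i) (entry i)
  inward : ∀ i, inner ℝ u (sheetNormal (sheet i) (side i)) < 0
  time_pos : ∀ i, 0 < time i
  exit_mem : ∀ i, OnSide (sheet i) (side (i + 1)) (entry i + time i • u)
  glue : ∀ i, entry (i + 1) =
    entry i + time i • u - (2 : ℝ) • sheetNormal (sheet i) (side (i + 1))
  sheet_succ : ∀ i, sheet (i + 1) = -sheet i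

namespace SurfaceTrajectory

variable {u : ℂ}

/-- The trajectory is back at its initial position after `N` crossings. -/
def ClosesAfter (τ : SurfaceTrajectory u) (N : ℕ) : Prop :=
  0 < N ∧ ∀ i, τ.entry (i + N) = τ.entry i ∧ τ.sheet (i + N) = τ.sheet i

/-- `τ` is periodic and the Euclidean length of one period is `ℓ`. -/
def HasLength (τ : SurfaceTrajectory u) (ℓ : ℝ) : Prop :=
  ∃ N, IsLeast {M | τ.ClosesAfter M} N ∧ ℓ = ∑ i ∈ Finset.range N, τ.time i * ‖u‖

/-- In every periodic direction the double pentagon has two cylinders of periodic trajectories,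
a short and a long one. The short periodic trajectories are those of minimal length among the
periodic trajectories in the same direction. -/
def IsShort (τ : SurfaceTrajectory u) : Prop :=
  ∃ ℓ, τ.HasLength ℓ ∧ ∀ (τ' : SurfaceTrajectory u) (ℓ' : ℝ), τ'.HasLength ℓ' → ℓ ≤ ℓ'

/-- The long periodic trajectories are those that are longer by the factor `φ` than the short
ones in the same direction. -/
def IsLong (τ : SurfaceTrajectory u) : Prop :=
  ∃ (τ' : SurfaceTrajectory u) (ℓ : ℝ), τ'.IsShort ∧ τ'.HasLength ℓ ∧ τ.HasLength (φ * ℓ)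

/-- `B` is the billiard trajectory that is obtained by folding `τ` into the table along every
side that `τ` crosses: the table is sheet `1`, and `B` starts in it at the same point and with the
same velocity as `τ` does on one of its visits to that sheet (which determines `B`). -/
def FoldsTo (τ : SurfaceTrajectory u) (B : BilliardTrajectory) : Prop :=
  ∃ i, τ.sheet i = 1 ∧ B.point 0 = τ.entry i ∧ B.dir 0 = u

end SurfaceTrajectory

/-! ### The tree of periodic directions -/

/-- The four matrices `σ₀, σ₁, σ₂, σ₃` in the Veech group of the golden L. -/
def sigma : Fin 4 → Matrix (Fin 2) (Fin 2) ℝ :=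
  ![!![1, φ; 0, 1], !![φ, φ; 1, φ], !![φ, 1; φ, φ], !![1, 0; φ, 1]]

/-- The vector on the golden L with tree word `w`. The letters are the indices of the matrices in
the order of application: the word `120` stands for `σ₀ σ₂ σ₁ (1, 0)`. -/
def treeVector (w : List (Fin 4)) : Fin 2 → ℝ :=
  w.foldl (fun v i => (sigma i).mulVec v) ![1, 0]

/-- The linear map from the golden L to the double pentagon. -/
def matrixP : Matrix (Fin 2) (Fin 2) ℝ :=
  !![1, Real.cos (Real.pi / 5); 0, Real.sin (Real.pi / 5)]

/-- The direction on the double pentagon, and on the table, with tree word `w`. -/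
def treeDirection (w : List (Fin 4)) : ℂ :=
  ⟨matrixP.mulVec (treeVector w) 0, matrixP.mulVec (treeVector w) 1⟩

/-- The billiard trajectories folded from the trajectories on the double pentagon in the direction
with tree word `w` and of the kind `K` (short or long) are rotationally symmetric and have
period `N`. There are such trajectories. -/
def TreeTrajectoriesSymmetricOfPeriod (w : List (Fin 4))
    (K : SurfaceTrajectory (treeDirection w) → Prop) (N : ℕ) : Prop :=
  (∃ τ, K τ) ∧ ∀ τ, K τ → (∃ B, τ.FoldsTo B) ∧
    ∀ B, τ.FoldsTo B → B.RotationallySymmetric ∧ B.HasPeriod N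

end

end PentagonBilliards

/-! Unfolding turns billiards in the pentagon into the linear flow on the double pentagon. Two
invariants of a closed surface trajectory matter: its number `N` of crossings, and the rotation in
`Fin 5` that the folding map has picked up after one period (`angle`). If this rotation is
nontrivial, the folded path returns rotated after `N` bounces; since 5 is prime, its trace is
invariant under all rotations and the motion first repeats after `5 * N` bounces (`fold_period`).
Repetition after an odd number of bounces is excluded when the flow is parallel to no side, because
the velocity would be fixed by a reflection.

Both invariants are found by counting. For the velocity `flowDir X y`, the function `level` is a
coordinate transverse to the flow, and crossing a side reflects it about the level of the midpoint
of that side. Hence two crossings, from the table back to the table, translate the level by `φ²`,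
`φ`, `-φ²X` or `-φX` (`two_steps`). If these translations occur `a`, `b`, `c`, `d` times in a closed
trajectory, then `aφ + b = (φc + d)X`, the length is proportional to `d + φc`, and the rotation is
`4a + 3b + c + 2d` mod 5 (`ClosesAfter.exists_counts`).

For the tree words in question `X` lies in `ℕ[φ]`, so irrationality of `φ` expresses `a` and `b`
through `c` and `d`, and the length determines `(c, d)`. This gives `N` and the rotation of every
short or long trajectory; the congruences on `k` make the rotation nonzero. Existence comes from
explicit periodic orbits of the return map on levels. Period 10 comes from a trajectory parallel to
a side, for which odd repetition is excluded by hand. -/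

namespace PentagonBilliards

noncomputable section

/-! ### Coordinates of the pentagon -/

/-- The sine of `π/5`. -/
def sn : ℝ := Real.sin (Real.pi / 5)

lemma sn_pos : 0 < sn :=
  Real.sin_pos_of_pos_of_lt_pi (by positivity) (by linarith [Real.pi_pos])

lemma phi_sq : φ * φ = φ + 1 := by
  have := Real.goldenRatio_sq
  rw [sq] at this
  exact this

lemma phi_lt : φ < 1.62 := by
  nlinarith [phi_sq, Real.one_lt_goldenRatio]

lemma lt_phi : 1.61 < φ := by
  nlinarith [phi_sq, Real.one_lt_goldenRatio]

lemma cos_fifth : Real.cos (Real.pi / 5) = φ / 2 := by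
  rw [Real.cos_pi_div_five, Real.goldenRatio]
  ring

lemma sn_sq : sn * sn = (3 - φ) / 4 := by
  have h := Real.sin_sq_add_cos_sq (Real.pi / 5)
  rw [cos_fifth] at h
  unfold sn
  linarith [phi_sq]

lemma zeta_eq : zeta = ⟨(φ - 1) / 2, φ * sn⟩ := by
  have h : zeta = Complex.exp (((2 * (Real.pi / 5) : ℝ) : ℂ) * Complex.I) := by
    unfold zeta
    congr 1
    push_cast
    ring
  rw [h]
  apply Complex.ext
  · rw [Complex.exp_ofReal_mul_I_re, Real.cos_two_mul, cos_fifth]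
    linarith [phi_sq]
  · rw [Complex.exp_ofReal_mul_I_im, Real.sin_two_mul, cos_fifth]
    simp only [sn]
    ring

lemma zeta_pow_two : zeta ^ 2 = ⟨-φ / 2, sn⟩ := by
  rw [sq, zeta_eq]
  apply Complex.ext
  · simp only [Complex.mul_re]
    linear_combination (1 / 2 - sn * sn) * phi_sq - (φ + 1) * sn_sq
  · simp only [Complex.mul_im]
    linear_combination sn * phi_sq

lemma zeta_pow_three : zeta ^ 3 = ⟨-φ / 2, -sn⟩ := by
  rw [pow_succ, zeta_pow_two, zeta_eq]
  apply Complex.ext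
  · simp only [Complex.mul_re]
    linear_combination (-1 / 4 + 1 / 4) * phi_sq - φ * sn_sq
  · simp only [Complex.mul_im]
    linear_combination (-sn / 2) * phi_sq

lemma zeta_pow_four : zeta ^ 4 = ⟨(φ - 1) / 2, -(φ * sn)⟩ := by
  rw [pow_succ, zeta_pow_three, zeta_eq]
  apply Complex.ext
  · simp only [Complex.mul_re]
    linear_combination (-1 / 4 - 1 / 4) * phi_sq + φ * sn_sq
  · simp only [Complex.mul_im]
    linear_combination (-sn / 2) * phi_sq

lemma zeta_pow_five : zeta ^ 5 = 1 := by
  unfold zeta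
  rw [← Complex.exp_nat_mul, ← Complex.exp_two_pi_mul_I]
  congr 1
  push_cast
  ring

lemma zeta_ne_zero : zeta ≠ 0 := Complex.exp_ne_zero _

lemma zeta_pow_add (a b : Fin 5) :
    zeta ^ ((a + b : Fin 5) : ℕ) = zeta ^ (a : ℕ) * zeta ^ (b : ℕ) := by
  rw [Fin.val_add, ← pow_add, ← pow_eq_pow_mod _ zeta_pow_five]

lemma conj_zeta_pow (a : Fin 5) :
    starRingEnd ℂ (zeta ^ (a : ℕ)) = zeta ^ ((-a : Fin 5) : ℕ) := by
  have h1 : zeta ^ ((-a : Fin 5) : ℕ) * zeta ^ (a : ℕ) = 1 := by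
    rw [← zeta_pow_add]
    simp
  have h2 : starRingEnd ℂ (zeta ^ (a : ℕ)) * zeta ^ (a : ℕ) = 1 := by
    have : starRingEnd ℂ zeta * zeta = 1 := by
      rw [zeta_eq]
      apply Complex.ext
      · simp only [Complex.mul_re, Complex.conj_re, Complex.conj_im, Complex.one_re]
        linear_combination (sn * sn) * phi_sq + (φ + 1) * sn_sq
      · simp only [Complex.mul_im, Complex.conj_re, Complex.conj_im, Complex.one_im]
        ring
    rw [map_pow, ← mul_pow, this, one_pow]
  have h0 : zeta ^ (a : ℕ) ≠ 0 := pow_ne_zero _ zeta_ne_zero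
  exact mul_right_cancel₀ h0 (h2.trans h1.symm)

lemma orderOf_zeta : orderOf zeta = 5 := by
  have : Fact (Nat.Prime 5) := ⟨by norm_num⟩
  refine orderOf_eq_prime zeta_pow_five fun h => ?_
  have h3 := congrArg Complex.re h
  simp only [zeta_eq, Complex.one_re] at h3
  linarith [phi_lt]

lemma zeta_pow_injective {a b : Fin 5} (h : zeta ^ (a : ℕ) = zeta ^ (b : ℕ)) : a = b := by
  apply Fin.ext
  refine pow_injOn_Iio_orderOf ?_ ?_ h <;> rw [orderOf_zeta] <;> exact Fin.is_lt _

lemma inner_eq (z w : ℂ) : inner ℝ z w = z.re * w.re + z.im * w.im := by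
  rw [Complex.inner, Complex.mul_re, Complex.conj_re, Complex.conj_im]
  ring

lemma normal_zero : normal 0 = ⟨0, -1⟩ := by
  apply Complex.ext <;> simp [normal]

lemma normal_one : normal 1 = ⟨φ * sn, -((φ - 1) / 2)⟩ := by
  apply Complex.ext <;> simp [normal, zeta_eq]

lemma normal_two : normal 2 = ⟨sn, φ / 2⟩ := by
  apply Complex.ext <;> simp [normal, zeta_pow_two]
  ring

lemma normal_three : normal 3 = ⟨-sn, φ / 2⟩ := by
  apply Complex.ext <;> simp [normal, zeta_pow_three]
  ring

lemma normal_four : normal 4 = ⟨-(φ * sn), -((φ - 1) / 2)⟩ := by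
  apply Complex.ext <;> simp [normal, zeta_pow_four]

lemma normal_add (a b : Fin 5) : normal (b + a) = zeta ^ (a : ℕ) * normal b := by
  rw [normal, normal, zeta_pow_add]
  ring

lemma conj_normal (a : Fin 5) : starRingEnd ℂ (normal a) = -normal (-a) := by
  rw [normal, normal, map_mul, conj_zeta_pow]
  simp

lemma norm_zeta_pow (a : ℕ) : ‖zeta ^ a‖ = 1 := by
  have h : zeta = Complex.exp (((2 * (Real.pi / 5) : ℝ) : ℂ) * Complex.I) := by
    unfold zeta
    congr 1
    push_cast
    ring
  rw [norm_pow, h, Complex.norm_exp_ofReal_mul_I, one_pow]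

lemma inner_mul_mul (c z w : ℂ) (hc : ‖c‖ = 1) : inner ℝ (c * z) (c * w) = inner ℝ z w := by
  have h : c.re * c.re + c.im * c.im = 1 := by
    have := Complex.normSq_apply c
    rw [Complex.normSq_eq_norm_sq, hc] at this
    linarith
  simp only [inner_eq, Complex.mul_re, Complex.mul_im]
  linear_combination (z.re * w.re + z.im * w.im) * h

lemma inner_conj_conj (z w : ℂ) :
    inner ℝ (starRingEnd ℂ z) (starRingEnd ℂ w) = inner ℝ z w := by
  simp

lemma mem_openSide_rotate (a j : Fin 5) (z : ℂ) :
    zeta ^ (a : ℕ) * z ∈ openSide (j + a) ↔ z ∈ openSide j := by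
  have key : ∀ i, inner ℝ (zeta ^ (a : ℕ) * z) (normal (i + a)) = inner ℝ z (normal i) := by
    intro i
    rw [normal_add, inner_mul_mul _ _ _ (norm_zeta_pow _)]
  have key' : ∀ i, inner ℝ (zeta ^ (a : ℕ) * z) (normal i) = inner ℝ z (normal (i - a)) := by
    intro i
    rw [← key, sub_add_cancel]
  simp only [openSide, pentagon, Set.mem_ofPred_eq, key']
  constructor
  · rintro ⟨h1, h2⟩
    refine ⟨fun i => ?_, fun i => ?_⟩
    · simpa using h1 (i + a)
    · simpa using h2 (i + a)
  · rintro ⟨h1, h2⟩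
    exact ⟨fun i => h1 _, fun i => (h2 _).trans sub_eq_iff_eq_add⟩

lemma forall_fin_five (p : Fin 5 → Prop) : (∀ i, p i) ↔ p 0 ∧ p 1 ∧ p 2 ∧ p 3 ∧ p 4 := by
  constructor
  · intro h
    exact ⟨h 0, h 1, h 2, h 3, h 4⟩
  · rintro ⟨h0, h1, h2, h3, h4⟩ i
    fin_cases i <;> assumption

/-- The constant `2 * sn * (φ - 1)` is `tan (π/5)`, half the side length at inradius 1. Only the two
adjacent sides bound the interval; the other two inequalities are slack on it. -/
lemma mem_openSide_zero (z : ℂ) :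
    z ∈ openSide 0 ↔ z.im = -1 ∧ |z.re| < 2 * sn * (φ - 1) := by
  have h1 := lt_phi
  have h1' := phi_lt
  have h2 := sn_pos
  have hp : φ * sn * (2 * sn * (φ - 1)) = (3 - φ) / 2 := by
    linear_combination (2 * sn * sn) * phi_sq + 2 * sn_sq
  simp only [openSide, pentagon, Set.mem_ofPred_eq, forall_fin_five, inner_eq, normal_zero,
    normal_one, normal_two, normal_three, normal_four]
  rw [abs_lt]
  constructor
  · rintro ⟨⟨-, a1, -, -, a4⟩, b0, b1, -, -, b4⟩
    have hz : z.im = -1 := by linarith [b0.2 trivial]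
    rw [hz] at a1 a4 b1 b4
    have c1 : z.re * (φ * sn) + -1 * -((φ - 1) / 2) < 1 :=
      lt_of_le_of_ne a1 fun h => by simpa using b1.1 h
    have c4 : z.re * -(φ * sn) + -1 * -((φ - 1) / 2) < 1 :=
      lt_of_le_of_ne a4 fun h => by simpa using b4.1 h
    have hpos : 0 < φ * sn := by positivity
    refine ⟨hz, ?_, ?_⟩
    · by_contra hcon
      push Not at hcon
      nlinarith [mul_le_mul_of_nonneg_left hcon hpos.le]
    · by_contra hcon
      push Not at hcon
      nlinarith [mul_le_mul_of_nonneg_left hcon hpos.le]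
  · rintro ⟨hz, a, b⟩
    have hpos : 0 < φ * sn := by positivity
    have c1 := mul_lt_mul_of_pos_left a hpos
    have c2 := mul_lt_mul_of_pos_left b hpos
    have d1 := mul_lt_mul_of_pos_left a h2
    have d2 := mul_lt_mul_of_pos_left b h2
    have e : sn * (2 * sn * (φ - 1)) ≤ 1 := by
      have : sn * (2 * sn * (φ - 1)) = (3 - φ) / 2 * (φ - 1) := by
        linear_combination 2 * (φ - 1) * sn_sq
      rw [this]
      nlinarith
    rw [hz]
    have f1 : z.re * (φ * sn) + -1 * -((φ - 1) / 2) < 1 := by linarith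
    have f4 : z.re * -(φ * sn) + -1 * -((φ - 1) / 2) < 1 := by linarith
    have f2 : z.re * sn + -1 * (φ / 2) < 1 := by linarith
    have f3 : z.re * -sn + -1 * (φ / 2) < 1 := by linarith
    refine ⟨⟨by simp, f1.le, f2.le, f3.le, f4.le⟩, by simp, ?_, ?_, ?_, ?_⟩
    · exact ⟨fun h => absurd h f1.ne, fun h => by simp at h⟩
    · exact ⟨fun h => absurd h f2.ne, fun h => by simp at h⟩
    · exact ⟨fun h => absurd h f3.ne, fun h => by simp at h⟩
    · exact ⟨fun h => absurd h f4.ne, fun h => by simp at h⟩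

/-- The side `j` consists of the points `normal j + t • zeta ^ j` with `t` smaller than half the
side length. -/
lemma mem_openSide_iff (j : Fin 5) (z : ℂ) :
    z ∈ openSide j ↔
      ∃ t : ℝ, |t| < 2 * sn * (φ - 1) ∧ z = normal j + t • zeta ^ (j : ℕ) := by
  have h0 : zeta ^ (j : ℕ) ≠ 0 := pow_ne_zero _ zeta_ne_zero
  obtain ⟨w, rfl⟩ : ∃ w, z = zeta ^ (j : ℕ) * w := ⟨z / zeta ^ (j : ℕ), by field_simp⟩
  have h := mem_openSide_rotate j 0 w
  rw [zero_add] at h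
  rw [h, mem_openSide_zero]
  constructor
  · rintro ⟨h1, h2⟩
    refine ⟨w.re, h2, ?_⟩
    have : w = -Complex.I + (w.re : ℂ) := by
      apply Complex.ext <;> simp [h1]
    rw [normal, Complex.real_smul]
    nth_rewrite 1 [this]
    ring
  · rintro ⟨t, ht, h3⟩
    have : w = -Complex.I + (t : ℂ) := by
      apply mul_left_cancel₀ h0
      rw [h3, normal, Complex.real_smul]
      ring
    rw [this]
    simpa using ht

lemma openSide_le {j : Fin 5} {z : ℂ} (hz : z ∈ openSide j) (i : Fin 5) :
    inner ℝ z (normal i) ≤ 1 := hz.1 i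

lemma openSide_eq {j : Fin 5} {z : ℂ} (hz : z ∈ openSide j) : inner ℝ z (normal j) = 1 :=
  (hz.2 j).2 rfl

lemma eq_of_openSide {j i : Fin 5} {z : ℂ} (hz : z ∈ openSide j)
    (h : inner ℝ z (normal i) = 1) : i = j := (hz.2 i).1 h

lemma inner_add_smul (z v w : ℂ) (t : ℝ) :
    inner ℝ (z + t • v) w = inner ℝ z w + t * inner ℝ v w := by
  rw [inner_add_left, real_inner_smul_left]

/-- A ray that enters the pentagon leaves it at only one point. -/
lemma exit_unique {j k l : Fin 5} {z v : ℂ} {s t : ℝ} (hz : z ∈ openSide j)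
    (hv : inner ℝ v (normal j) < 0) (hs : 0 < s) (ht : 0 < t)
    (hk : z + s • v ∈ openSide k) (hl : z + t • v ∈ openSide l) : s = t ∧ k = l := by
  have aux : ∀ {k l : Fin 5} {s t : ℝ}, 0 < s → 0 < t → z + s • v ∈ openSide k →
      z + t • v ∈ openSide l → t ≤ s := by
    intro k l s t hs ht hk hl
    by_contra! hst
    have h1 := openSide_eq hk
    have h2 := openSide_le hl k
    have h3 := openSide_le hz k
    rw [inner_add_smul] at h1 h2
    -- Being on side `k` at time `s` but inside the pentagon at times `0` and `t > s` forces motion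
    -- parallel to side `k`; then the ray starts on that side, against `hv`.
    have h4 : inner ℝ v (normal k) = 0 := by
      have h5 : inner ℝ v (normal k) ≤ 0 := by nlinarith
      have h6 : 0 ≤ inner ℝ v (normal k) := by nlinarith
      linarith
    rw [h4, mul_zero, add_zero] at h1
    rw [eq_of_openSide hz h1] at h4
    linarith
  have h := le_antisymm (aux ht hs hl hk) (aux hs ht hk hl)
  subst h
  exact ⟨rfl, eq_of_openSide hl (openSide_eq hk)⟩

/-! ### Folding -/

/-- The linear isometry that maps the sheet `ε` to the table and is a rotation by `a` fifths of a
full turn, preceded by complex conjugation if `ε = -1`. -/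
def foldMap (ε : ℤˣ) (a : Fin 5) (z : ℂ) : ℂ :=
  zeta ^ (a : ℕ) * if ε = 1 then z else starRingEnd ℂ z

/-- The side of the table onto which `foldMap ε a` maps the side `j` of sheet `ε`. -/
def foldSide (ε : ℤˣ) (a j : Fin 5) : Fin 5 := if ε = 1 then j + a else a - j

/-- The rotation part of the folding map after crossing the side `j` of sheet `ε`. -/
def stepAngle (ε : ℤˣ) (a j : Fin 5) : Fin 5 := if ε = 1 then a + 2 * j else a - 2 * j

lemma neg_one_ne_one_units : ¬ ((-1 : ℤˣ) = 1) := by decide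

lemma foldMap_add (ε : ℤˣ) (a : Fin 5) (z w : ℂ) :
    foldMap ε a (z + w) = foldMap ε a z + foldMap ε a w := by
  unfold foldMap
  split_ifs
  · ring
  · rw [map_add]
    ring

lemma foldMap_smul (ε : ℤˣ) (a : Fin 5) (t : ℝ) (z : ℂ) :
    foldMap ε a (t • z) = t • foldMap ε a z := by
  unfold foldMap
  simp only [Complex.real_smul]
  split_ifs
  · ring
  · rw [map_mul, Complex.conj_ofReal]
    ring

lemma foldMap_angle_add (ε : ℤˣ) (a b : Fin 5) (z : ℂ) :
    foldMap ε (a + b) z = zeta ^ (b : ℕ) * foldMap ε a z := by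
  unfold foldMap
  rw [zeta_pow_add]
  ring

lemma inner_foldMap (ε : ℤˣ) (a : Fin 5) (z w : ℂ) :
    inner ℝ (foldMap ε a z) (foldMap ε a w) = inner ℝ z w := by
  unfold foldMap
  rw [inner_mul_mul _ _ _ (norm_zeta_pow _)]
  split_ifs
  · rfl
  · exact inner_conj_conj z w

lemma foldMap_injective (ε : ℤˣ) (a : Fin 5) : Function.Injective (foldMap ε a) := by
  intro z w h
  have h1 := mul_left_cancel₀ (pow_ne_zero (a : ℕ) zeta_ne_zero) h
  split_ifs at h1
  · exact h1
  · exact (starRingEnd ℂ).injective h1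

lemma foldMap_angle_injective {ε : ℤˣ} {a b : Fin 5} {z : ℂ} (hz : z ≠ 0)
    (h : foldMap ε a z = foldMap ε b z) : a = b := by
  refine zeta_pow_injective (mul_right_cancel₀ ?_ h)
  split_ifs
  · exact hz
  · simpa using hz

lemma sheetNormal_one (j : Fin 5) : sheetNormal 1 j = normal j := by simp [sheetNormal]

lemma sheetNormal_neg_one (j : Fin 5) : sheetNormal (-1) j = -normal j := by simp [sheetNormal]

lemma sheetNormal_neg (ε : ℤˣ) (j : Fin 5) : sheetNormal (-ε) j = -sheetNormal ε j := by
  simp [sheetNormal]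

lemma foldMap_sheetNormal (ε : ℤˣ) (a j : Fin 5) :
    foldMap ε a (sheetNormal ε j) = normal (foldSide ε a j) := by
  unfold foldMap foldSide
  rcases Int.units_eq_one_or ε with rfl | rfl
  · rw [if_pos rfl, if_pos rfl, sheetNormal_one, normal_add]
  · rw [if_neg neg_one_ne_one_units, if_neg neg_one_ne_one_units, sheetNormal_neg_one, map_neg,
      conj_normal, neg_neg, sub_eq_neg_add, normal_add]

/-- Side `j` has direction `zeta ^ j`, and the reflection in the line through `0` with direction
`c`, `‖c‖ = 1`, is `z ↦ c ^ 2 * conj z`. -/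
lemma reflect_eq (j : Fin 5) (z : ℂ) :
    z - (2 * inner ℝ z (normal j)) • normal j =
      zeta ^ ((2 * j : Fin 5) : ℕ) * starRingEnd ℂ z := by
  have h := norm_zeta_pow (j : ℕ)
  have h2 : ∀ j : Fin 5, 2 * j = j + j := by decide
  rw [h2 j, zeta_pow_add]
  have h1 : (zeta ^ (j : ℕ)).re * (zeta ^ (j : ℕ)).re +
      (zeta ^ (j : ℕ)).im * (zeta ^ (j : ℕ)).im = 1 := by
    rw [← Complex.normSq_apply, Complex.normSq_eq_norm_sq, h, one_pow]
  rw [inner_eq, normal]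
  generalize zeta ^ (j : ℕ) = c at h1
  apply Complex.ext
  · simp
    linear_combination (-z.re) * h1
  · simp
    linear_combination (-z.im) * h1

/-- This is the folding rule: the folding map on the next sheet is the old one composed with the
linear reflection in the crossed side, which is why `stepAngle` moves by twice the index of the
side. -/
lemma foldMap_stepAngle (ε : ℤˣ) (a j : Fin 5) (z : ℂ) :
    foldMap (-ε) (stepAngle ε a j) z =
      foldMap ε a (z - (2 * inner ℝ z (sheetNormal ε j)) • sheetNormal ε j) := by
  have h : z - (2 * inner ℝ z (sheetNormal ε j)) • sheetNormal ε j =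
      z - (2 * inner ℝ z (normal j)) • normal j := by
    rcases Int.units_eq_one_or ε with rfl | rfl
    · rw [sheetNormal_one]
    · rw [sheetNormal_neg_one, inner_neg_right, smul_neg, mul_neg, neg_smul, neg_neg]
  rw [h, reflect_eq]
  unfold foldMap stepAngle
  rcases Int.units_eq_one_or ε with rfl | rfl
  · rw [if_neg neg_one_ne_one_units, if_pos rfl, if_pos rfl, zeta_pow_add]
    ring
  · rw [neg_neg, if_pos rfl, if_neg neg_one_ne_one_units, if_neg neg_one_ne_one_units, map_mul,
      conj_zeta_pow, Complex.conj_conj, sub_eq_add_neg, zeta_pow_add]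
    ring

lemma foldSide_stepAngle (ε : ℤˣ) (a j : Fin 5) :
    foldSide (-ε) (stepAngle ε a j) j = foldSide ε a j := by
  unfold foldSide stepAngle
  rcases Int.units_eq_one_or ε with rfl | rfl
  · rw [if_neg neg_one_ne_one_units, if_pos rfl, if_pos rfl]
    revert a j
    decide
  · rw [neg_neg, if_pos rfl, if_neg neg_one_ne_one_units, if_neg neg_one_ne_one_units]
    revert a j
    decide

lemma neg_conj_mem_openSide {j : Fin 5} {z : ℂ} (hz : z ∈ openSide j) :
    -starRingEnd ℂ z ∈ openSide (-j) := by
  rw [mem_openSide_iff] at hz ⊢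
  obtain ⟨t, ht, rfl⟩ := hz
  refine ⟨-t, by rwa [abs_neg], ?_⟩
  rw [map_add, conj_normal, Complex.real_smul, map_mul, Complex.conj_ofReal, conj_zeta_pow,
    Complex.real_smul]
  push_cast
  ring

lemma foldMap_mem_openSide {ε : ℤˣ} {j : Fin 5} {z : ℂ} (a : Fin 5) (hz : OnSide ε j z) :
    foldMap ε a z ∈ openSide (foldSide ε a j) := by
  unfold foldMap foldSide
  unfold OnSide at hz
  rcases Int.units_eq_one_or ε with rfl | rfl
  · rw [if_pos rfl, if_pos rfl, mem_openSide_rotate]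
    simpa using hz
  · rw [if_neg neg_one_ne_one_units, if_neg neg_one_ne_one_units, sub_eq_neg_add,
      mem_openSide_rotate]
    have := neg_conj_mem_openSide hz
    simpa using this

lemma inner_of_onSide {ε : ℤˣ} {j : Fin 5} {z : ℂ} (hz : OnSide ε j z) :
    inner ℝ z (sheetNormal ε j) = 1 := by
  have h := openSide_eq hz
  rw [real_inner_smul_left] at h
  rw [sheetNormal, real_inner_smul_right]
  exact h

lemma onSide_unique {ε : ℤˣ} {j k : Fin 5} {z : ℂ} (hj : OnSide ε j z) (hk : OnSide ε k z) :
    j = k :=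
  eq_of_openSide hk (openSide_eq hj)

namespace SurfaceTrajectory

variable {u : ℂ}

/-- The rotation part of the folding map after `n` crossings, starting from the `i`-th one. -/
def angle (τ : SurfaceTrajectory u) (i : ℕ) : ℕ → Fin 5
  | 0 => 0
  | n + 1 => stepAngle (τ.sheet (i + n)) (angle τ i n) (τ.side (i + n + 1))

lemma foldMap_angle_succ (τ : SurfaceTrajectory u) (i n : ℕ) (z : ℂ) :
    foldMap (τ.sheet (i + (n + 1))) (τ.angle i (n + 1)) z =
      foldMap (τ.sheet (i + n)) (τ.angle i n)
        (z - (2 * inner ℝ z (sheetNormal (τ.sheet (i + n)) (τ.side (i + n + 1)))) •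
          sheetNormal (τ.sheet (i + n)) (τ.side (i + n + 1))) := by
  rw [← add_assoc, τ.sheet_succ, angle, foldMap_stepAngle]

lemma normal_foldSide_succ (τ : SurfaceTrajectory u) (i n : ℕ) :
    foldSide (τ.sheet (i + (n + 1))) (τ.angle i (n + 1)) (τ.side (i + (n + 1))) =
      foldSide (τ.sheet (i + n)) (τ.angle i n) (τ.side (i + n + 1)) := by
  rw [← add_assoc, τ.sheet_succ, angle, foldSide_stepAngle]

/-- The billiard trajectory obtained by folding a trajectory on the double pentagon, starting from
its `i`-th crossing. -/
def fold (τ : SurfaceTrajectory u) (i : ℕ) : BilliardTrajectory where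
  point n := foldMap (τ.sheet (i + n)) (τ.angle i n) (τ.entry (i + n))
  dir n := foldMap (τ.sheet (i + n)) (τ.angle i n) u
  side n := foldSide (τ.sheet (i + n)) (τ.angle i n) (τ.side (i + n))
  point_mem n := foldMap_mem_openSide _ (τ.entry_mem _)
  inward n := by
    rw [← foldMap_sheetNormal, inner_foldMap]
    exact τ.inward _
  advance n := by
    refine ⟨τ.time (i + n), τ.time_pos _, ?_⟩
    have h := inner_of_onSide (τ.exit_mem (i + n))
    have h' : inner ℝ (sheetNormal (τ.sheet (i + n)) (τ.side (i + n + 1)))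
        (sheetNormal (τ.sheet (i + n)) (τ.side (i + n + 1))) = 1 := by
      rw [← inner_foldMap (τ.sheet (i + n)) 0, foldMap_sheetNormal, ← inner_mul_mul _ _ _
        (norm_zeta_pow ((-(foldSide (τ.sheet (i + n)) 0 (τ.side (i + n + 1))) : Fin 5) : ℕ)),
        ← normal_add, add_neg_cancel, inner_eq, normal_zero]
      norm_num
    rw [foldMap_angle_succ, ← foldMap_smul, ← foldMap_add, ← add_assoc, τ.glue]
    congr 1
    -- With unit normal `n`, the exit point `z` has inner product `1` with `n`, so `z - 2 • n` has
    -- inner product `-1` and the reflection sends it back to `z`.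
    rw [inner_sub_left, real_inner_smul_left, h, h']
    module
  reflect n := by
    rw [foldMap_angle_succ, normal_foldSide_succ, ← foldMap_sheetNormal, inner_foldMap,
      sub_eq_add_neg, foldMap_add, ← neg_smul, foldMap_smul, neg_smul, sub_eq_add_neg]

lemma foldsTo_fold (τ : SurfaceTrajectory u) {i : ℕ} (hi : τ.sheet i = 1) :
    τ.FoldsTo (τ.fold i) := by
  refine ⟨i, hi, ?_, ?_⟩ <;> simp [fold, foldMap, angle, hi]

end SurfaceTrajectory

/-- Billiard motion is deterministic, and the point determines the side. Hence `fold` gives every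
billiard trajectory that `FoldsTo` allows. -/
lemma BilliardTrajectory.eq_of_start {B B' : BilliardTrajectory} (hp : B.point 0 = B'.point 0)
    (hd : B.dir 0 = B'.dir 0) : B = B' := by
  have hside : ∀ n, B.point n = B'.point n → B.side n = B'.side n := fun n h =>
    eq_of_openSide (B'.point_mem n) (h ▸ openSide_eq (B.point_mem n))
  have h : ∀ n, B.point n = B'.point n ∧ B.dir n = B'.dir n := by
    intro n
    induction n with
    | zero => exact ⟨hp, hd⟩
    | succ n ih =>
      obtain ⟨s, hs, h1⟩ := B.advance n
      obtain ⟨t, ht, h2⟩ := B'.advance n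
      rw [← ih.1, ← ih.2] at h2
      have h3 := B.point_mem (n + 1)
      have h4 := B'.point_mem (n + 1)
      rw [h1] at h3
      rw [h2] at h4
      obtain ⟨rfl, h5⟩ := exit_unique (B.point_mem n) (B.inward n) hs ht h3 h4
      refine ⟨h1.trans h2.symm, ?_⟩
      rw [B.reflect, B'.reflect, ih.2, h5]
  have h1 : B.point = B'.point := funext fun n => (h n).1
  have h2 : B.dir = B'.dir := funext fun n => (h n).2
  have h3 : B.side = B'.side := funext fun n => hside n (h n).1
  cases B
  cases B'
  simp only at h1 h2 h3
  subst h1 h2 h3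
  rfl

/-! ### Closed trajectories and the rotation of the folding map -/

namespace SurfaceTrajectory

variable {u : ℂ}

lemma FoldsTo.exists_eq_fold {τ : SurfaceTrajectory u} {B : BilliardTrajectory}
    (h : τ.FoldsTo B) : ∃ i, τ.sheet i = 1 ∧ B = τ.fold i := by
  obtain ⟨i, hi, hp, hd⟩ := h
  refine ⟨i, hi, BilliardTrajectory.eq_of_start ?_ ?_⟩
  · simp [hp, fold, foldMap, angle, hi]
  · simp [hd, fold, foldMap, angle, hi]

lemma exists_foldsTo (τ : SurfaceTrajectory u) : ∃ B, τ.FoldsTo B := by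
  rcases Int.units_eq_one_or (τ.sheet 0) with h | h
  · exact ⟨_, τ.foldsTo_fold h⟩
  · exact ⟨_, τ.foldsTo_fold (i := 1) (by rw [τ.sheet_succ, h, neg_neg])⟩

lemma sheet_add_even (τ : SurfaceTrajectory u) (i : ℕ) {n : ℕ} (hn : Even n) :
    τ.sheet (i + n) = τ.sheet i := by
  obtain ⟨k, rfl⟩ := hn
  induction k with
  | zero => rfl
  | succ k ih =>
    rw [show i + (k + 1 + (k + 1)) = i + (k + k) + 1 + 1 by ring, τ.sheet_succ, τ.sheet_succ,
      neg_neg, ih]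

lemma sheet_add_odd (τ : SurfaceTrajectory u) (i : ℕ) {n : ℕ} (hn : Odd n) :
    τ.sheet (i + n) = -τ.sheet i := by
  obtain ⟨k, rfl⟩ := hn
  rw [← add_assoc, τ.sheet_succ, τ.sheet_add_even i (even_two_mul k)]

lemma neg_ne_self_units (ε : ℤˣ) : -ε ≠ ε := by
  revert ε
  decide

lemma ClosesAfter.even {τ : SurfaceTrajectory u} {N : ℕ} (h : τ.ClosesAfter N) : Even N := by
  by_contra hN
  have h1 := τ.sheet_add_odd 0 (Nat.not_even_iff_odd.1 hN)
  rw [(h.2 0).2] at h1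
  exact neg_ne_self_units _ h1.symm

lemma ClosesAfter.side {τ : SurfaceTrajectory u} {N : ℕ} (h : τ.ClosesAfter N) (i : ℕ) :
    τ.side (i + N) = τ.side i := by
  have h1 := τ.entry_mem (i + N)
  rw [(h.2 i).1, (h.2 i).2] at h1
  exact onSide_unique h1 (τ.entry_mem i)

lemma ClosesAfter.mul {τ : SurfaceTrajectory u} {N : ℕ} (h : τ.ClosesAfter N) (i q : ℕ) :
    τ.entry (i + q * N) = τ.entry i ∧ τ.sheet (i + q * N) = τ.sheet i := by
  induction q with
  | zero => simp
  | succ q ih => rw [add_mul, one_mul, ← add_assoc, (h.2 _).1, (h.2 _).2, ih.1, ih.2]; simp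

/-- It suffices to check the closing condition from some index on. -/
lemma ClosesAfter.of_tail {τ : SurfaceTrajectory u} {N M i : ℕ} (h : τ.ClosesAfter N)
    (hM : 0 < M) (h' : ∀ n, τ.entry (i + n + M) = τ.entry (i + n)) (hE : Even M) :
    τ.ClosesAfter M := by
  refine ⟨hM, fun n => ⟨?_, τ.sheet_add_even n hE⟩⟩
  -- Shifting by `i` full periods moves any index beyond `i` without changing the entry point.
  have h1 : i ≤ n + i * N := by nlinarith [h.1]
  obtain ⟨k, hk⟩ := Nat.exists_eq_add_of_le h1
  rw [← (h.mul (n + M) i).1, ← (h.mul n i).1, add_right_comm, hk, h']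

lemma dvd_of_closesAfter {τ : SurfaceTrajectory u} {N M : ℕ}
    (hN : IsLeast {M | τ.ClosesAfter M} N) (hM : τ.ClosesAfter M) : N ∣ M := by
  by_contra hdvd
  have hpos : 0 < M % N := Nat.pos_of_ne_zero fun h => hdvd (Nat.dvd_of_mod_eq_zero h)
  have hlt : M % N < N := Nat.mod_lt _ hN.1.1
  have hc : τ.ClosesAfter (M % N) := by
    refine ⟨hpos, fun i => ?_⟩
    have h1 : i + M = i + M % N + M / N * N := by
      have := Nat.mod_add_div M N
      rw [mul_comm] at this
      omega
    rw [← (ClosesAfter.mul hN.1 (i + M % N) (M / N)).1,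
      ← (ClosesAfter.mul hN.1 (i + M % N) (M / N)).2, ← h1]
    exact hM.2 i
  exact absurd (hN.2 hc) (not_le.2 hlt)

lemma exists_isLeast {τ : SurfaceTrajectory u} {M : ℕ} (hM : τ.ClosesAfter M) :
    ∃ N, IsLeast {M | τ.ClosesAfter M} N := by
  classical
  exact ⟨Nat.find ⟨M, hM⟩, Nat.find_spec ⟨M, hM⟩, fun K hK => Nat.find_min' _ hK⟩

lemma stepAngle_add (ε : ℤˣ) (a b j : Fin 5) : stepAngle ε (a + b) j = stepAngle ε a j + b := by
  unfold stepAngle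
  split_ifs <;> abel

lemma ClosesAfter.angle_add {τ : SurfaceTrajectory u} {N : ℕ} (h : τ.ClosesAfter N) (i n : ℕ) :
    τ.angle i (n + N) = τ.angle i n + τ.angle i N := by
  induction n with
  | zero => simp [angle]
  | succ n ih =>
    rw [show n + 1 + N = n + N + 1 by ring, angle, ih, stepAngle_add, angle]
    congr 2
    · rw [← add_assoc, (h.2 _).2]
    · rw [show i + (n + N) + 1 = i + n + 1 + N by ring, h.side]

lemma ClosesAfter.angle_add_mul {τ : SurfaceTrajectory u} {N : ℕ} (h : τ.ClosesAfter N)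
    (i n q : ℕ) : τ.angle i (n + q * N) = τ.angle i n + q • τ.angle i N := by
  induction q with
  | zero => simp
  | succ q ih => rw [add_mul, one_mul, ← add_assoc, h.angle_add, ih, succ_nsmul, add_assoc]

lemma ClosesAfter.fold_point {τ : SurfaceTrajectory u} {N : ℕ} (h : τ.ClosesAfter N)
    (i n q : ℕ) : (τ.fold i).point (n + q * N) =
      zeta ^ ((q • τ.angle i N : Fin 5) : ℕ) * (τ.fold i).point n := by
  simp only [fold]
  rw [h.angle_add_mul, ← add_assoc, (h.mul _ _).1, (h.mul _ _).2, foldMap_angle_add]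

lemma ClosesAfter.fold_dir {τ : SurfaceTrajectory u} {N : ℕ} (h : τ.ClosesAfter N)
    (i n q : ℕ) : (τ.fold i).dir (n + q * N) =
      zeta ^ ((q • τ.angle i N : Fin 5) : ℕ) * (τ.fold i).dir n := by
  simp only [fold]
  rw [h.angle_add_mul, ← add_assoc, (h.mul _ _).2, foldMap_angle_add]

lemma ne_zero_of_trajectory (τ : SurfaceTrajectory u) : u ≠ 0 := by
  rintro rfl
  have := τ.inward 0
  rw [inner_zero_left] at this
  exact lt_irrefl _ this

/-- An even number of crossings preserves the sheet. Equal velocities then force equal folding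
rotations, as `u ≠ 0`, and injectivity of the folding map recovers the entry points. -/
lemma closesAfter_of_repeatsAfter {τ : SurfaceTrajectory u} {N M i : ℕ} (h : τ.ClosesAfter N)
    (hM : (τ.fold i).RepeatsAfter M) (hE : Even M) : τ.ClosesAfter M ∧ τ.angle i M = 0 := by
  have key : ∀ n, τ.angle i (n + M) = τ.angle i n := fun n => by
    have h1 := (hM.2 n).2
    simp only [fold] at h1
    rw [← add_assoc, τ.sheet_add_even _ hE] at h1
    exact foldMap_angle_injective τ.ne_zero_of_trajectory h1
  refine ⟨h.of_tail hM.1 (i := i) (fun n => ?_) hE, ?_⟩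
  · have h1 := (hM.2 n).1
    simp only [fold] at h1
    rw [← add_assoc, τ.sheet_add_even _ hE, key] at h1
    exact foldMap_injective _ _ h1
  · simpa [angle] using key 0

lemma five_dvd_of_nsmul {a : Fin 5} (ha : a ≠ 0) {q : ℕ} (h : q • a = 0) : 5 ∣ q := by
  have h5 : ∀ b : Fin 5, 5 • b = 0 := by decide
  rw [← Nat.mod_add_div q 5, add_nsmul, mul_comm, mul_nsmul', h5, nsmul_zero, add_zero] at h
  have hlt : q % 5 < 5 := Nat.mod_lt _ (by norm_num)
  have aux : ∀ r : Fin 5, ∀ b : Fin 5, b ≠ 0 → (r : ℕ) • b = 0 → (r : ℕ) = 0 := by decide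
  exact Nat.dvd_of_mod_eq_zero (aux ⟨q % 5, hlt⟩ a ha h)

lemma exists_nsmul_eq {a : Fin 5} (ha : a ≠ 0) (b : Fin 5) : ∃ q : ℕ, q • a = b := by
  have aux : ∀ a : Fin 5, a ≠ 0 → ∀ b : Fin 5, ∃ r : Fin 5, (r : ℕ) • a = b := by decide
  obtain ⟨r, hr⟩ := aux a ha b
  exact ⟨r, hr⟩

lemma rotate_segment (z w : ℂ) :
    (fun x => zeta * x) '' segment ℝ z w = segment ℝ (zeta * z) (zeta * w) :=
  image_segment ℝ (LinearMap.mulLeft ℝ zeta).toAffineMap z w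

/-- If the folding map of a closed trajectory after one period is a nontrivial rotation, then the
folded trajectory is rotationally symmetric, and its period is five times as long. -/
theorem fold_period {τ : SurfaceTrajectory u} {N i : ℕ}
    (hN : IsLeast {M | τ.ClosesAfter M} N) (hodd : ∀ M, Odd M → ¬ (τ.fold i).RepeatsAfter M)
    (ha : τ.angle i N ≠ 0) :
    (τ.fold i).RotationallySymmetric ∧ (τ.fold i).HasPeriod (5 * N) := by
  have h : τ.ClosesAfter N := hN.1
  have h5 : (5 : ℕ) • τ.angle i N = 0 := by
    generalize τ.angle i N = b
    revert b
    decide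
  refine ⟨?_, ⟨⟨by have := h.1; omega, fun n => ?_⟩, fun M hM => ?_⟩⟩
  · have hrot : ∀ q : ℕ, q • τ.angle i N = 1 → ∀ n, (fun x => zeta * x) ''
        segment ℝ ((τ.fold i).point n) ((τ.fold i).point (n + 1)) =
        segment ℝ ((τ.fold i).point (n + q * N)) ((τ.fold i).point (n + q * N + 1)) := by
      intro q hq n
      rw [rotate_segment, add_right_comm, h.fold_point, h.fold_point, hq, Fin.val_one, pow_one]
    -- Some number `q` of periods turns the path by exactly `2π/5`, so rotating the trace shifts its
    -- segments by `q * N`.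
    obtain ⟨q, hq⟩ := exists_nsmul_eq ha 1
    unfold BilliardTrajectory.RotationallySymmetric BilliardTrajectory.trace
    rw [Set.image_iUnion]
    simp only [hrot q hq]
    apply Set.Subset.antisymm
    · exact Set.iUnion_subset fun n => Set.subset_iUnion (fun n => segment ℝ
        ((τ.fold i).point n) ((τ.fold i).point (n + 1))) (n + q * N)
    · refine Set.iUnion_subset fun n => ?_
      -- The shift reaches every segment: segment `n` equals segment `n + 5 * q * N`, whose rotation
      -- is trivial, and the latter is the shift of segment `n + 4 * q * N`.
      refine subset_trans (Eq.subset ?_) (Set.subset_iUnion (fun n => segment ℝ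
        ((τ.fold i).point (n + q * N)) ((τ.fold i).point (n + q * N + 1))) (n + 4 * q * N))
      have hq5 : (5 * q) • τ.angle i N = 0 := by
        rw [mul_comm, mul_nsmul', h5, nsmul_zero]
      have h1 : n + 4 * q * N + q * N = n + 5 * q * N := by ring
      simp only [h1]
      rw [add_right_comm, h.fold_point, h.fold_point, hq5, Fin.val_zero, pow_zero, one_mul,
        one_mul]
  · rw [h.fold_point, h.fold_dir, h5]
    simp
  · by_cases hE : Even M
    · obtain ⟨h1, h2⟩ := closesAfter_of_repeatsAfter h hM hE
      obtain ⟨q, rfl⟩ := dvd_of_closesAfter hN h1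
      have h3 := h.angle_add_mul i 0 q
      rw [zero_add, mul_comm, h2] at h3
      obtain ⟨r, rfl⟩ := five_dvd_of_nsmul ha (q := q) (by simpa [angle] using h3.symm)
      have h4 : 0 < r := by
        rcases Nat.eq_zero_or_pos r with rfl | h4
        · simpa using hM.1
        · exact h4
      nlinarith [h.1]
    · exact absurd hM (hodd M (Nat.not_even_iff_odd.1 hE))

/-- After an odd number of crossings the folding map contains a conjugation, so repetition of the
velocity would make `u` invariant under some `zeta ^ c * conj`. As 2 is invertible mod 5, this is
the reflection in the direction of a side, and `u` would be parallel to that side. -/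
lemma fold_not_repeatsAfter_odd (τ : SurfaceTrajectory u) {i M : ℕ}
    (hu : ∀ j, inner ℝ u (normal j) ≠ 0) (hM : Odd M) : ¬ (τ.fold i).RepeatsAfter M := by
  intro h
  have h1 := (h.2 0).2
  simp only [fold, zero_add, add_zero] at h1
  rw [τ.sheet_add_odd i hM] at h1
  have key : ∀ a b : Fin 5, zeta ^ (a : ℕ) * starRingEnd ℂ u = zeta ^ (b : ℕ) * u → False := by
    intro a b hab
    have hc : ∃ j : Fin 5, 2 * j = a - b := by
      generalize a - b = c
      revert c
      decide
    obtain ⟨j, hj⟩ := hc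
    have h2 : zeta ^ ((2 * j : Fin 5) : ℕ) * starRingEnd ℂ u = u := by
      apply mul_left_cancel₀ (pow_ne_zero (b : ℕ) zeta_ne_zero)
      rw [← mul_assoc, ← zeta_pow_add, hj, add_sub_cancel, hab]
    rw [← reflect_eq, sub_eq_self, smul_eq_zero] at h2
    rcases h2 with h2 | h2
    · exact hu j (by linarith)
    · exact hu j (by rw [h2, inner_zero_right])
  rcases Int.units_eq_one_or (τ.sheet i) with hs | hs <;> rw [hs] at h1 <;>
    simp only [foldMap, neg_neg, if_true, if_neg neg_one_ne_one_units] at h1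
  · exact key _ _ h1
  · exact key _ _ h1.symm

end SurfaceTrajectory

/-! ### Levels along a linear flow -/

/-- The directions that make an angle less than `π/5` with the horizontal sides. -/
def flowDir (X y : ℝ) : ℂ := ⟨y * (X + φ / 2), y * sn⟩

/-- An affine function that is constant along the flow with velocity `flowDir X y`. -/
def level (X : ℝ) (z : ℂ) : ℝ := (3 * φ + 1) / 5 * ((X + φ / 2) * (z.im + 1) - sn * z.re) + 1 / 2

/-- The level of the midpoint of a side. -/
def midLevel (X : ℝ) : Fin 5 → ℝ :=
  ![1 / 2, (φ * X + 1) / 2, φ * X + 1 + (X + φ) / 2, φ * X + φ + 1 + X / 2,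
    1 + (φ * X + φ) / 2]

/-- The increment of the level along a side. -/
def levelSpan (X : ℝ) : Fin 5 → ℝ :=
  ![-1, φ * X + 1, X + φ, -X, -(φ * X + φ)]

lemma level_add_smul_flowDir (X y t : ℝ) (z : ℂ) :
    level X (z + t • flowDir X y) = level X z := by
  simp only [level, flowDir, Complex.add_re, Complex.add_im, Complex.smul_re, Complex.smul_im,
    smul_eq_mul]
  ring

lemma level_normal (X : ℝ) (j : Fin 5) : level X (normal j) = midLevel X j := by
  revert j
  rw [forall_fin_five, normal_zero, normal_one, normal_two, normal_three, normal_four]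
  have h1 := phi_sq
  have h2 := sn_sq
  refine ⟨?_, ?_, ?_, ?_, ?_⟩ <;> simp [level, midLevel] <;> grind

lemma level_add_smul_zeta (X t : ℝ) (j : Fin 5) (z : ℂ) :
    level X (z + t • zeta ^ (j : ℕ)) = level X z + (3 * φ + 1) / 5 * sn * t * levelSpan X j := by
  revert j
  have h1 := phi_sq
  have h2 := sn_sq
  rw [forall_fin_five]
  refine ⟨?_, ?_, ?_, ?_, ?_⟩ <;> simp [level, levelSpan]
  · ring
  · rw [zeta_eq]
    simp only
    grind
  · rw [zeta_pow_two]
    simp only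
    grind
  · rw [zeta_pow_three]
    simp only
    grind
  · rw [zeta_pow_four]
    simp only
    grind

/-- Once both sheets are identified with the table, the gluing along side `j` is the half-turn about
the midpoint `normal j`; hence levels are reflected about `midLevel X j`. -/
lemma level_two_normal_sub (X : ℝ) (j : Fin 5) (z : ℂ) :
    level X ((2 : ℝ) • normal j - z) = 2 * midLevel X j - level X z := by
  rw [← level_normal]
  simp [level]
  ring

/-- The sign of `levelSpan` thus tells through which sides the flow leaves the table: for `0 < X`
and `0 < y`, through sides 1 and 2. It leaves the reflected sheet through sides 0, 3 and 4. -/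
lemma inner_flowDir (X y : ℝ) (j : Fin 5) :
    inner ℝ (flowDir X y) (normal j) = y * sn * levelSpan X j := by
  revert j
  have h1 := phi_sq
  rw [forall_fin_five, normal_zero, normal_one, normal_two, normal_three, normal_four]
  refine ⟨?_, ?_, ?_, ?_, ?_⟩ <;> simp [levelSpan, flowDir] <;> grind

/-- The factor `(3 * φ + 1) / 5` in `level` normalizes the bottom side to levels from 0 to 1. -/
lemma levelScale : (3 * φ + 1) / 5 * sn * (2 * sn * (φ - 1)) = 1 / 2 := by
  have h1 := phi_sq
  have h2 := sn_sq
  grind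

lemma phi_pos : 0 < φ := Real.goldenRatio_pos

lemma levelScale_pos : 0 < (3 * φ + 1) / 5 * sn := by
  have := sn_pos
  have := phi_pos
  positivity

lemma levelSpan_ne_zero {X : ℝ} (hX : 0 < X) (j : Fin 5) : levelSpan X j ≠ 0 := by
  have := phi_pos
  revert j
  rw [forall_fin_five]
  refine ⟨?_, ?_, ?_, ?_, ?_⟩ <;> simp [levelSpan] <;> first | positivity | (intro h; nlinarith)

lemma abs_level_sub_lt {X : ℝ} (hX : 0 < X) {j : Fin 5} {z : ℂ} (hz : z ∈ openSide j) :
    |level X z - midLevel X j| < |levelSpan X j| / 2 := by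
  obtain ⟨t, ht, rfl⟩ := (mem_openSide_iff j z).1 hz
  rw [level_add_smul_zeta, level_normal, add_sub_cancel_left, abs_mul, abs_mul,
    abs_of_pos levelScale_pos]
  have h1 := mul_lt_mul_of_pos_left ht levelScale_pos
  rw [levelScale] at h1
  have h2 := mul_lt_mul_of_pos_right h1 (abs_pos.2 (levelSpan_ne_zero hX j))
  linarith

/-- The range of levels on a side. -/
lemma level_bounds {X : ℝ} (hX : 0 < X) {z : ℂ} :
    (z ∈ openSide 0 → 0 < level X z ∧ level X z < 1) ∧
    (z ∈ openSide 1 → 0 < level X z ∧ level X z < φ * X + 1) ∧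
    (z ∈ openSide 2 → φ * X + 1 < level X z ∧ level X z < φ * X + φ + 1 + X) ∧
    (z ∈ openSide 3 → φ * X + φ + 1 < level X z ∧ level X z < φ * X + φ + 1 + X) ∧
    (z ∈ openSide 4 → 1 < level X z ∧ level X z < φ * X + φ + 1) := by
  have hp := phi_pos
  have hpX : 0 < φ * X := by positivity
  refine ⟨?_, ?_, ?_, ?_, ?_⟩ <;> intro hz <;> have h := abs_level_sub_lt hX hz <;>
    simp only [midLevel, levelSpan, Matrix.cons_val, abs_neg, abs_one] at h
  · rw [abs_lt] at h
    constructor <;> linarith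
  · rw [abs_of_pos (a := φ * X + 1) (by positivity), abs_lt] at h
    constructor <;> linarith
  · rw [abs_of_pos (a := X + φ) (by positivity), abs_lt] at h
    constructor <;> linarith
  · rw [abs_of_pos (a := X) (by positivity), abs_lt] at h
    constructor <;> linarith
  · rw [abs_of_pos (a := φ * X + φ) (by positivity), abs_lt] at h
    constructor <;> linarith

/-! ### Counting crossings by their effect on the level -/

namespace SurfaceTrajectory

/-- The level of the position of `τ`, in a copy of the table, while it crosses its `i`-th sheet. -/
def levelAt {X y : ℝ} (τ : SurfaceTrajectory (flowDir X y)) (i : ℕ) : ℝ :=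
  level X (((τ.sheet i : ℤ) : ℝ) • τ.entry i)

section

variable {X y : ℝ} (τ : SurfaceTrajectory (flowDir X y))

lemma level_exit (i : ℕ) :
    level X (((τ.sheet i : ℤ) : ℝ) • (τ.entry i + τ.time i • flowDir X y)) = τ.levelAt i := by
  rw [smul_add, smul_smul, level_add_smul_flowDir, levelAt]

lemma levelAt_succ (i : ℕ) :
    τ.levelAt (i + 1) = 2 * midLevel X (τ.side (i + 1)) - τ.levelAt i := by
  rw [← τ.level_exit i, ← level_two_normal_sub, levelAt, τ.glue, τ.sheet_succ, sheetNormal]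
  congr 1
  rcases Int.units_eq_one_or (τ.sheet i) with h | h <;> rw [h] <;> simp
  abel

lemma span_pos (hy : 0 < y) (i : ℕ) :
    0 < ((τ.sheet i : ℤ) : ℝ) * levelSpan X (τ.side (i + 1)) := by
  have h := τ.inward (i + 1)
  rw [τ.sheet_succ, sheetNormal_neg, inner_neg_right, sheetNormal, real_inner_smul_right,
    inner_flowDir] at h
  have h1 := mul_pos hy sn_pos
  by_contra! hcon
  nlinarith

lemma side_of_sheet_one (hX : 0 < X) (hy : 0 < y) {i : ℕ} (hi : τ.sheet i = 1) :
    τ.side (i + 1) = 1 ∨ τ.side (i + 1) = 2 := by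
  have h := τ.span_pos hy i
  have hp := phi_pos
  have hpX : 0 < φ * X := by positivity
  rw [hi] at h
  generalize τ.side (i + 1) = j at h
  fin_cases j <;> simp [levelSpan] at h ⊢ <;> linarith

lemma side_of_sheet_neg_one (hX : 0 < X) (hy : 0 < y) {i : ℕ} (hi : τ.sheet i = -1) :
    τ.side (i + 1) = 0 ∨ τ.side (i + 1) = 3 ∨ τ.side (i + 1) = 4 := by
  have h := τ.span_pos hy i
  have hp := phi_pos
  have hpX : 0 < φ * X := by positivity
  rw [hi] at h
  generalize τ.side (i + 1) = j at h
  fin_cases j <;> simp [levelSpan] at h ⊢ <;> linarith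

/-- Two successive crossings, starting from the table. -/
lemma two_steps (hX : 0 < X) (hy : 0 < y) {i : ℕ} (hi : τ.sheet i = 1) :
    (τ.side (i + 1) = 1 ∧ τ.side (i + 2) = 4 ∧ τ.levelAt i < φ * X ∧
      τ.levelAt (i + 2) = τ.levelAt i + (φ + 1)) ∨
    (τ.side (i + 1) = 2 ∧ τ.side (i + 2) = 3 ∧ φ * X + 1 < τ.levelAt i ∧
      τ.levelAt (i + 2) = τ.levelAt i + φ) ∨
    (τ.side (i + 1) = 2 ∧ τ.side (i + 2) = 4 ∧ φ * X + 1 < τ.levelAt i ∧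
      τ.levelAt (i + 2) = τ.levelAt i - (φ * X + X)) ∨
    (τ.side (i + 1) = 1 ∧ τ.side (i + 2) = 0 ∧ τ.levelAt i < φ * X + 1 ∧
      τ.levelAt (i + 2) = τ.levelAt i - φ * X) := by
  have hi' : τ.sheet (i + 1) = -1 := by rw [τ.sheet_succ, hi]
  have h1 := τ.levelAt_succ i
  have h2 := τ.levelAt_succ (i + 1)
  have e1 := τ.exit_mem i
  have e2 := τ.exit_mem (i + 1)
  unfold OnSide at e1 e2
  have b1 := level_bounds hX (z := ((τ.sheet i : ℤ) : ℝ) •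
    (τ.entry i + τ.time i • flowDir X y))
  have b2 := level_bounds hX (z := ((τ.sheet (i + 1) : ℤ) : ℝ) •
    (τ.entry (i + 1) + τ.time (i + 1) • flowDir X y))
  rw [τ.level_exit] at b1 b2
  rcases τ.side_of_sheet_one hX hy hi with s1 | s1 <;>
    rcases τ.side_of_sheet_neg_one hX hy hi' with s2 | s2 | s2 <;>
    rw [s1] at h1 e1 <;> rw [s2] at h2 e2 <;>
    simp only [midLevel, Matrix.cons_val] at h1 h2
  · have c1 := b1.2.1 e1
    have c2 := b2.1 e2
    exact Or.inr (Or.inr (Or.inr ⟨s1, s2, c1.2, by linarith⟩))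
  -- Impossible pair: the reflected level stays in the range of side 1, below that of side 3.
  -- Likewise side 2 is never followed by side 0.
  · have c1 := b1.2.1 e1
    have c2 := b2.2.2.2.1 e2
    linarith [phi_pos]
  · have c1 := b1.2.1 e1
    have c2 := b2.2.2.2.2 e2
    exact Or.inl ⟨s1, s2, by linarith, by linarith⟩
  · have c1 := b1.2.2.1 e1
    have c2 := b2.1 e2
    have : 0 < φ * X := by have := phi_pos; positivity
    linarith
  · have c1 := b1.2.2.1 e1
    have c2 := b2.2.2.2.1 e2
    exact Or.inr (Or.inl ⟨s1, s2, c1.1, by linarith⟩)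
  · have c1 := b1.2.2.1 e1
    have c2 := b2.2.2.2.2 e2
    exact Or.inr (Or.inr (Or.inl ⟨s1, s2, c1.1, by linarith⟩))

lemma entry_im_two_steps {i : ℕ} (hi : τ.sheet i = 1) :
    (τ.entry (i + 2)).im = (τ.entry i).im + (τ.time i + τ.time (i + 1)) * (y * sn)
      - 2 * (normal (τ.side (i + 1))).im + 2 * (normal (τ.side (i + 2))).im := by
  have hi' : τ.sheet (i + 1) = -1 := by rw [τ.sheet_succ, hi]
  have h1 := congrArg Complex.im (τ.glue i)
  have h2 := congrArg Complex.im (τ.glue (i + 1))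
  rw [hi, sheetNormal_one] at h1
  rw [hi', sheetNormal_neg_one] at h2
  simp [flowDir] at h1 h2
  rw [h2, h1]
  ring

lemma angle_two_steps {i n : ℕ} (h : τ.sheet (i + n) = 1) :
    τ.angle i (n + 2) =
      τ.angle i n + 2 * τ.side (i + n + 1) - 2 * τ.side (i + n + 2) := by
  rw [angle, angle, ← add_assoc i n 1, τ.sheet_succ, h, stepAngle, if_neg neg_one_ne_one_units,
    stepAngle, if_pos rfl]

/-- The position after `2 * n` crossings, in terms of the numbers of pairs of crossings of each of
the four kinds in `two_steps`. -/
lemma exists_counts (hX : 0 < X) (hy : 0 < y) {i : ℕ} (hi : τ.sheet i = 1) (n : ℕ) :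
    ∃ a b c d : ℕ, n = a + b + c + d ∧
      τ.levelAt (i + 2 * n) = τ.levelAt i + a * (φ + 1) + b * φ - c * (φ * X + X) - d * (φ * X) ∧
      (τ.angle i (2 * n) : ℕ) = (4 * a + 3 * b + c + 2 * d) % 5 ∧
      (∑ k ∈ Finset.range (2 * n), τ.time (i + k)) * (y * sn) =
        (τ.entry (i + 2 * n)).im - (τ.entry i).im + (3 - φ) * (d + φ * c) ∧
      (c = 0 → b ≠ 0 → φ * X + 1 < τ.levelAt (i + 2 * n)) ∧
      (c = 0 → φ * X + 1 < τ.levelAt i → a = 0 ∧ d = 0) := by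
  have hp := phi_pos
  induction n with
  | zero => exact ⟨0, 0, 0, 0, by simp [angle]⟩
  | succ n ih =>
    -- `hb` and `hs` record that only the pair (2, 4), counted by `c`, can lead from above `φ * X +
    -- 1` to below it: the pairs through side 1 start below, and (2, 3) raises the level.
    obtain ⟨a, b, c, d, hn, hl, ha, ht, hb, hs⟩ := ih
    have hi' : τ.sheet (i + 2 * n) = 1 := by rw [τ.sheet_add_even i (even_two_mul n), hi]
    have him := τ.entry_im_two_steps hi'
    have hang := τ.angle_two_steps hi'
    have hsum : ∑ k ∈ Finset.range (2 * (n + 1)), τ.time (i + k) =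
        ∑ k ∈ Finset.range (2 * n), τ.time (i + k) +
          (τ.time (i + 2 * n) + τ.time (i + 2 * n + 1)) := by
      rw [mul_add, mul_one, Finset.sum_range_succ, Finset.sum_range_succ]
      simp only [add_assoc]
    have hang' : ∀ (x y z : Fin 5) (k : ℕ), (∀ x : Fin 5,
        ((x + 2 * y - 2 * z : Fin 5) : ℕ) = (x + k) % 5) →
        ((x + 2 * y - 2 * z : Fin 5) : ℕ) = (x + k) % 5 := fun x _ _ _ h => h x
    rw [show i + 2 * (n + 1) = i + 2 * n + 2 by ring, show 2 * (n + 1) = 2 * n + 2 by ring] at *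
    have hφ := phi_sq
    rcases τ.two_steps hX hy hi' with ⟨s1, s2, h1, h2⟩ | ⟨s1, s2, h1, h2⟩ |
      ⟨s1, s2, h1, h2⟩ | ⟨s1, s2, h1, h2⟩ <;> rw [s1, s2] at hang him
    · refine ⟨a + 1, b, c, d, by omega, ?_, ?_, ?_, ?_, ?_⟩
      · rw [h2, hl]
        push_cast
        ring
      · rw [hang, hang' _ _ _ 4 (by decide), ha]
        omega
      · rw [normal_one, normal_four] at him
        rw [hsum, add_mul, ht, him]
        ring
      · intro hc hb'
        have := hb hc hb'
        linarith
      · intro hc hlt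
        obtain ⟨rfl, rfl⟩ := hs hc hlt
        subst hc
        simp at hl
        have : 0 ≤ b * φ := by positivity
        linarith
    · refine ⟨a, b + 1, c, d, by omega, ?_, ?_, ?_, ?_, ?_⟩
      · rw [h2, hl]
        push_cast
        ring
      · rw [hang, hang' _ _ _ 3 (by decide), ha]
        omega
      · rw [normal_two, normal_three] at him
        rw [hsum, add_mul, ht, him]
        ring
      · intro _ _
        linarith
      · exact hs
    · refine ⟨a, b, c + 1, d, by omega, ?_, ?_, ?_, by simp, by simp⟩
      · rw [h2, hl]
        push_cast
        ring
      · rw [hang, hang' _ _ _ 1 (by decide), ha]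
        omega
      · rw [normal_two, normal_four] at him
        rw [hsum, add_mul, ht, him]
        push_cast
        linear_combination hφ
    · refine ⟨a, b, c, d + 1, by omega, ?_, ?_, ?_, ?_, ?_⟩
      · rw [h2, hl]
        push_cast
        ring
      · rw [hang, hang' _ _ _ 2 (by decide), ha]
        omega
      · rw [normal_one, normal_zero] at him
        rw [hsum, add_mul, ht, him]
        push_cast
        ring
      · intro hc hb'
        have := hb hc hb'
        linarith
      · intro hc hlt
        obtain ⟨rfl, rfl⟩ := hs hc hlt
        subst hc
        simp at hl
        have : 0 ≤ b * φ := by positivity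
        linarith

end

lemma ClosesAfter.time {u : ℂ} {τ : SurfaceTrajectory u} {N : ℕ} (h : τ.ClosesAfter N) (i : ℕ) :
    τ.time (i + N) = τ.time i := by
  have h1 := τ.exit_mem (i + N)
  have h2 := τ.entry_mem i
  have h3 := τ.exit_mem i
  have h4 := τ.inward i
  rw [(h.2 i).1, (h.2 i).2] at h1
  unfold OnSide at h1 h2 h3
  rw [smul_add, smul_comm] at h1 h3
  refine (exit_unique h2 ?_ (τ.time_pos _) (τ.time_pos _) h1 h3).1
  rw [real_inner_smul_left]
  rw [sheetNormal, real_inner_smul_right] at h4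
  exact h4

lemma ClosesAfter.sum_time {u : ℂ} {τ : SurfaceTrajectory u} {N : ℕ} (h : τ.ClosesAfter N)
    (i : ℕ) : ∑ k ∈ Finset.range N, τ.time (i + k) = ∑ k ∈ Finset.range N, τ.time k := by
  induction i with
  | zero => simp
  | succ i ih =>
    have h1 := Finset.sum_range_succ (fun k => τ.time (i + k)) N
    have h2 := Finset.sum_range_succ' (fun k => τ.time (i + k)) N
    rw [h1, h.time, add_zero] at h2
    rw [← ih, add_right_cancel h2]
    simp only [add_assoc, add_comm 1]

/-- The unit in which the lengths of periodic trajectories are measured. -/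
def unitLength (X y : ℝ) : ℝ := (3 - φ) / (y * sn) * ‖flowDir X y‖

lemma unitLength_pos {X y : ℝ} (hy : 0 < y) : 0 < unitLength X y := by
  have h1 : 0 < 3 - φ := by linarith [phi_lt]
  have h2 := sn_pos
  have h3 : flowDir X y ≠ 0 := fun h => by
    have := congrArg Complex.im h
    simp [flowDir, hy.ne', h2.ne'] at this
  have h4 := norm_pos_iff.2 h3
  unfold unitLength
  positivity

/-- The constraints on the numbers of pairs of crossings in a closed trajectory. -/
theorem ClosesAfter.exists_counts {X y : ℝ} {τ : SurfaceTrajectory (flowDir X y)} (hX : 0 < X)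
    (hy : 0 < y) {N i : ℕ} (h : τ.ClosesAfter N) (hi : τ.sheet i = 1) :
    ∃ a b c d : ℕ, N = 2 * (a + b + c + d) ∧ a * φ + b = (φ * c + d) * X ∧
      (τ.angle i N : ℕ) = (4 * a + 3 * b + c + 2 * d) % 5 ∧
      ∑ k ∈ Finset.range N, τ.time k * ‖flowDir X y‖ = (d + φ * c) * unitLength X y ∧
      (c = 0 → b = 0) ∧ 0 < c + d := by
  obtain ⟨n, hn⟩ := h.even
  rw [← two_mul] at hn
  obtain ⟨a, b, c, d, h1, h2, h3, h4, h5, h6⟩ := τ.exists_counts hX hy hi n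
  have hp := phi_pos
  rw [← hn] at h2 h3 h4 h5
  rw [h.sum_time, (h.2 i).1, sub_self, zero_add] at h4
  have hlev : τ.levelAt (i + N) = τ.levelAt i := by
    rw [levelAt, levelAt, (h.2 i).1, (h.2 i).2]
  rw [hlev] at h2 h5
  -- The level translations of a closed trajectory cancel; `φ + 1 = φ²` makes a factor `φ` common to
  -- all of them.
  have h7 : (a * φ + b) * φ = (φ * c + d) * X * φ := by
    linear_combination (a - c * X) * phi_sq - h2
  refine ⟨a, b, c, d, by omega, mul_right_cancel₀ hp.ne' h7, h3, ?_, ?_, ?_⟩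
  · have h8 : y * sn ≠ 0 := (mul_pos hy sn_pos).ne'
    rw [← Finset.sum_mul, unitLength, eq_div_of_mul_eq h8 h4]
    ring
  -- If `c = 0` and `b ≠ 0`, the trajectory ends, hence starts, above `φ * X + 1`; so `a = d = 0`,
  -- and the level would have grown by `b * φ > 0`.
  · intro hc
    by_contra hb
    obtain ⟨rfl, rfl⟩ := h6 hc (h5 hc hb)
    subst hc
    have : (0 : ℝ) < b := by exact_mod_cast Nat.pos_of_ne_zero hb
    simp only [Nat.cast_zero, mul_zero, zero_mul, add_zero, zero_add] at h7
    have : 0 < b * φ := by positivity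
    linarith
  -- The total time is proportional to `d + φ * c` and cannot vanish.
  · by_contra hcd
    obtain ⟨rfl, rfl⟩ : c = 0 ∧ d = 0 := by omega
    have : 0 < ∑ k ∈ Finset.range N, τ.time k :=
      Finset.sum_pos (fun k _ => τ.time_pos k) ⟨0, Finset.mem_range.2 h.1⟩
    have := mul_pos this (mul_pos hy sn_pos)
    simp at h4
    rw [← mul_assoc] at this
    rcases h4 with h4 | h4 | h4
    · rw [h4] at this
      simp at this
    · exact hy.ne' h4
    · exact sn_pos.ne' h4

end SurfaceTrajectory

/-! ### Construction of trajectories from their levels -/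

/-- The point of level `h` on the line that contains the side `j`. -/
def sidePoint (X : ℝ) (j : Fin 5) (h : ℝ) : ℂ :=
  normal j + ((h - midLevel X j) / ((3 * φ + 1) / 5 * sn * levelSpan X j)) • zeta ^ (j : ℕ)

lemma level_sidePoint {X : ℝ} (hX : 0 < X) (j : Fin 5) (h : ℝ) :
    level X (sidePoint X j h) = h := by
  have h1 := levelScale_pos
  have h2 := levelSpan_ne_zero hX j
  rw [sidePoint, level_add_smul_zeta, level_normal]
  generalize (3 * φ + 1) / 5 * sn = K at h1
  have h3 := h1.ne'
  field_simp
  ring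

lemma sidePoint_reflect (X : ℝ) (j : Fin 5) (h : ℝ) :
    sidePoint X j (2 * midLevel X j - h) = (2 : ℝ) • normal j - sidePoint X j h := by
  rw [sidePoint, sidePoint, show 2 * midLevel X j - h - midLevel X j = -(h - midLevel X j) by ring,
    neg_div, neg_smul, two_smul]
  ring

/-- `h` is the level of a point in the interior of the side `j`. -/
def InRange (X : ℝ) (j : Fin 5) (h : ℝ) : Prop := |h - midLevel X j| < |levelSpan X j| / 2

lemma sidePoint_mem {X : ℝ} (hX : 0 < X) {j : Fin 5} {h : ℝ} (hh : InRange X j h) :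
    sidePoint X j h ∈ openSide j := by
  rw [mem_openSide_iff]
  refine ⟨_, ?_, rfl⟩
  have h1 := levelScale_pos
  have h2 := abs_pos.2 (levelSpan_ne_zero hX j)
  have h3 := levelScale
  unfold InRange at hh
  rw [abs_div, abs_mul, abs_of_pos h1, div_lt_iff₀ (mul_pos h1 h2)]
  linear_combination hh - |levelSpan X j| * h3

/-- The side through which the flow leaves the table at level `h`. -/
def outSide (X h : ℝ) : Fin 5 := if h < φ * X + 1 then 1 else 2

/-- The side through which the flow enters the table at level `h`. -/
def inSide (X h : ℝ) : Fin 5 := if h < 1 then 0 else if h < φ * X + φ + 1 then 4 else 3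

/-- The levels in the table that are not the level of a vertex. -/
structure Generic (X h : ℝ) : Prop where
  pos : 0 < h
  lt : h < φ * X + φ + 1 + X
  ne_one : h ≠ 1
  ne_low : h ≠ φ * X + 1
  ne_high : h ≠ φ * X + φ + 1

lemma inRange_iff {X h : ℝ} (hX : 0 < X) :
    (InRange X 0 h ↔ 0 < h ∧ h < 1) ∧
    (InRange X 1 h ↔ 0 < h ∧ h < φ * X + 1) ∧
    (InRange X 2 h ↔ φ * X + 1 < h ∧ h < φ * X + φ + 1 + X) ∧
    (InRange X 3 h ↔ φ * X + φ + 1 < h ∧ h < φ * X + φ + 1 + X) ∧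
    (InRange X 4 h ↔ 1 < h ∧ h < φ * X + φ + 1) := by
  have hp := phi_pos
  have hpX : 0 < φ * X := by positivity
  refine ⟨?_, ?_, ?_, ?_, ?_⟩ <;>
    simp only [InRange, midLevel, levelSpan, Matrix.cons_val, abs_neg, abs_one]
  · rw [abs_lt]
    constructor <;> rintro ⟨h1, h2⟩ <;> constructor <;> linarith
  · rw [abs_of_pos (a := φ * X + 1) (by positivity), abs_lt]
    constructor <;> rintro ⟨h1, h2⟩ <;> constructor <;> linarith
  · rw [abs_of_pos (a := X + φ) (by positivity), abs_lt]
    constructor <;> rintro ⟨h1, h2⟩ <;> constructor <;> linarith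
  · rw [abs_of_pos (a := X) (by positivity), abs_lt]
    constructor <;> rintro ⟨h1, h2⟩ <;> constructor <;> linarith
  · rw [abs_of_pos (a := φ * X + φ) (by positivity), abs_lt]
    constructor <;> rintro ⟨h1, h2⟩ <;> constructor <;> linarith

lemma Generic.outSide_inRange {X h : ℝ} (hX : 0 < X) (hh : Generic X h) :
    InRange X (outSide X h) h := by
  obtain ⟨-, b1, b2, -, -⟩ := inRange_iff (h := h) hX
  unfold outSide
  split_ifs with h1
  · exact b1.2 ⟨hh.pos, h1⟩
  · exact b2.2 ⟨lt_of_le_of_ne (not_lt.1 h1) hh.ne_low.symm, hh.lt⟩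

lemma Generic.inSide_inRange {X h : ℝ} (hX : 0 < X) (hh : Generic X h) :
    InRange X (inSide X h) h := by
  obtain ⟨b0, -, -, b3, b4⟩ := inRange_iff (h := h) hX
  unfold inSide
  split_ifs with h1 h2
  · exact b0.2 ⟨hh.pos, h1⟩
  · exact b4.2 ⟨lt_of_le_of_ne (not_lt.1 h1) hh.ne_one.symm, h2⟩
  · exact b3.2 ⟨lt_of_le_of_ne (not_lt.1 h2) hh.ne_high.symm, hh.lt⟩

/-- The reflection preserves the range of levels of the side, so the side of entry into the next
sheet can be recomputed from the new level. -/
lemma Generic.outSide_reflect {X h : ℝ} (hh : Generic X h) :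
    outSide X (2 * midLevel X (outSide X h) - h) = outSide X h := by
  obtain ⟨h1, h2, h3, h4, h5⟩ := hh
  by_cases hlt : h < φ * X + 1
  · have : outSide X h = 1 := if_pos hlt
    rw [this]
    simp only [midLevel, Matrix.cons_val]
    exact if_pos (by linarith)
  · have : outSide X h = 2 := if_neg hlt
    rw [this]
    simp only [midLevel, Matrix.cons_val]
    exact if_neg (by linarith)

lemma Generic.inSide_reflect {X h : ℝ} (hX : 0 < X) (hh : Generic X h) :
    inSide X (2 * midLevel X (inSide X h) - h) = inSide X h := by
  have hp := phi_pos
  have hpX : 0 < φ * X := by positivity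
  obtain ⟨h1, h2, h3, h4, h5⟩ := hh
  by_cases hlt : h < 1
  · have : inSide X h = 0 := if_pos hlt
    rw [this]
    simp only [midLevel, Matrix.cons_val]
    exact if_pos (by linarith)
  by_cases hlt' : h < φ * X + φ + 1
  · have : inSide X h = 4 := by rw [inSide, if_neg hlt, if_pos hlt']
    have hlt'' := lt_of_le_of_ne (not_lt.1 hlt) h3.symm
    rw [this]
    simp only [midLevel, Matrix.cons_val]
    rw [inSide, if_neg (by linarith), if_pos (by linarith)]
  · have : inSide X h = 3 := by rw [inSide, if_neg hlt, if_neg hlt']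
    rw [this]
    simp only [midLevel, Matrix.cons_val]
    rw [inSide, if_neg (by linarith), if_neg (by linarith)]

lemma levelSpan_outSide {X : ℝ} (hX : 0 < X) (h : ℝ) : 0 < levelSpan X (outSide X h) := by
  have hp := phi_pos
  unfold outSide
  split_ifs <;> simp only [levelSpan, Matrix.cons_val] <;> positivity

lemma levelSpan_inSide {X : ℝ} (hX : 0 < X) (h : ℝ) : levelSpan X (inSide X h) < 0 := by
  have hp := phi_pos
  unfold inSide
  split_ifs <;> simp only [levelSpan, Matrix.cons_val] <;> rw [neg_lt_zero] <;> positivity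

/-- Two boundary points of the same level are joined by the flow. -/
lemma exists_flow_time {X y : ℝ} (hy : 0 < y) {j k : Fin 5} {z w : ℂ}
    (hz : z ∈ openSide j) (hw : w ∈ openSide k) (hl : level X z = level X w)
    (hj : levelSpan X j < 0) (hk : 0 < levelSpan X k) :
    ∃ t : ℝ, 0 < t ∧ w = z + t • flowDir X y := by
  have hs := sn_pos
  have hys := mul_pos hy hs
  have hp := phi_pos
  have h1 : (X + φ / 2) * (w.im - z.im) = sn * (w.re - z.re) := by
    have hK : (3 * φ + 1) / 5 ≠ 0 := by positivity
    apply mul_left_cancel₀ hK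
    unfold level at hl
    linear_combination -hl
  have h2 : w = z + ((w.im - z.im) / (y * sn)) • flowDir X y := by
    apply Complex.ext
    · simp only [flowDir, Complex.add_re, Complex.smul_re, smul_eq_mul]
      field_simp
      linear_combination (-4) * h1
    · simp only [flowDir, Complex.add_im, Complex.smul_im, smul_eq_mul]
      field_simp
      ring
  refine ⟨_, ?_, h2⟩
  generalize (w.im - z.im) / (y * sn) = t at h2
  -- The flow points outwards at side `k`, so `t < 0` would put `z` beyond that side, and `t = 0`
  -- would put `z` on it, although the flow enters at `z`.
  have h3 := openSide_eq hw
  have h4 := openSide_le hz k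
  rw [h2, inner_add_smul, inner_flowDir] at h3
  have h5 : 0 < y * sn * levelSpan X k := mul_pos hys hk
  by_contra! ht
  have h6 : t = 0 := by nlinarith
  rw [h6, zero_mul, add_zero] at h3
  have := eq_of_openSide hz h3
  rw [this] at hk
  linarith

section

variable (X : ℝ) (h : ℕ → ℝ)

/-- The side through which a trajectory with levels `h i` enters its `i`-th sheet. -/
def entrySide (i : ℕ) : Fin 5 := if Even i then inSide X (h i) else outSide X (h i)

/-- The side through which a trajectory with levels `h i` leaves its `i`-th sheet. -/
def exitSide (i : ℕ) : Fin 5 := if Even i then outSide X (h i) else inSide X (h i)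

end

lemma exists_time {X y : ℝ} (hX : 0 < X) (hy : 0 < y) {h : ℕ → ℝ} (hg : ∀ i, Generic X (h i))
    (i : ℕ) : ∃ t : ℝ, 0 < t ∧
      ((((-1) ^ i : ℤˣ) : ℤ) : ℝ) • sidePoint X (entrySide X h i) (h i) + t • flowDir X y =
      ((((-1) ^ i : ℤˣ) : ℤ) : ℝ) • sidePoint X (exitSide X h i) (h i) := by
  have h1 := sidePoint_mem hX ((hg i).inSide_inRange hX)
  have h2 := sidePoint_mem hX ((hg i).outSide_inRange hX)
  obtain ⟨t, ht, h3⟩ := exists_flow_time (y := y) hy h1 h2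
    (by rw [level_sidePoint hX, level_sidePoint hX]) (levelSpan_inSide hX _)
    (levelSpan_outSide hX _)
  refine ⟨t, ht, ?_⟩
  by_cases hi : Even i
  · rw [entrySide, exitSide, if_pos hi, if_pos hi, hi.neg_one_pow, h3]
    simp
  · rw [entrySide, exitSide, if_neg hi, if_neg hi, (Nat.not_even_iff_odd.1 hi).neg_one_pow, h3]
    simp

/-- The trajectory with given generic levels. -/
def ofLevels {X y : ℝ} (hX : 0 < X) (hy : 0 < y) (h : ℕ → ℝ) (hg : ∀ i, Generic X (h i))
    (hs : ∀ i, h (i + 1) = 2 * midLevel X (exitSide X h i) - h i) :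
    SurfaceTrajectory (flowDir X y) :=
  have hside : ∀ i, entrySide X h (i + 1) = exitSide X h i := fun i => by
    by_cases hi : Even i
    · have h1 := hs i
      rw [exitSide, if_pos hi] at h1 ⊢
      rw [entrySide, if_neg (by simpa [Nat.even_add_one] using hi), h1, (hg i).outSide_reflect]
    · have h1 := hs i
      rw [exitSide, if_neg hi] at h1 ⊢
      rw [entrySide, if_pos (by simpa [Nat.even_add_one] using hi), h1,
        (hg i).inSide_reflect hX]
  have hsq : ∀ i (z : ℂ), ((((-1) ^ i : ℤˣ) : ℤ) : ℝ) • ((((-1) ^ i : ℤˣ) : ℤ) : ℝ) • z = z :=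
    fun i z => by
      rcases Int.units_eq_one_or ((-1) ^ i) with h | h <;> rw [h] <;> simp
  { sheet := fun i => (-1) ^ i
    entry := fun i => ((((-1) ^ i : ℤˣ) : ℤ) : ℝ) • sidePoint X (entrySide X h i) (h i)
    side := entrySide X h
    time := fun i => (exists_time hX hy hg i).choose
    entry_mem := fun i => by
      rw [OnSide, hsq]
      apply sidePoint_mem hX
      unfold entrySide
      split_ifs
      · exact (hg i).inSide_inRange hX
      · exact (hg i).outSide_inRange hX
    inward := fun i => by
      rw [sheetNormal, real_inner_smul_right, inner_flowDir]
      have h1 := mul_pos hy sn_pos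
      have h2 := levelSpan_inSide hX (h i)
      have h3 := levelSpan_outSide hX (h i)
      by_cases hi : Even i
      · rw [entrySide, if_pos hi, hi.neg_one_pow]
        simp
        nlinarith
      · rw [entrySide, if_neg hi, (Nat.not_even_iff_odd.1 hi).neg_one_pow]
        simp
        positivity
    time_pos := fun i => (exists_time hX hy hg i).choose_spec.1
    exit_mem := fun i => by
      rw [OnSide, (exists_time hX hy hg i).choose_spec.2, hsq, hside]
      apply sidePoint_mem hX
      unfold exitSide
      split_ifs
      · exact (hg i).outSide_inRange hX
      · exact (hg i).inSide_inRange hX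
    glue := fun i => by
      rw [(exists_time hX hy hg i).choose_spec.2, hside, hs, sidePoint_reflect, sheetNormal,
        pow_succ]
      push_cast
      module
    sheet_succ := fun i => by rw [pow_succ, mul_neg_one] }

lemma ofLevels_closesAfter {X y : ℝ} (hX : 0 < X) (hy : 0 < y) (h : ℕ → ℝ)
    (hg : ∀ i, Generic X (h i)) (hs : ∀ i, h (i + 1) = 2 * midLevel X (exitSide X h i) - h i)
    {N : ℕ} (hN : 0 < N) (hE : Even N) (hper : ∀ i, h (i + N) = h i) :
    (ofLevels hX hy h hg hs).ClosesAfter N := by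
  refine ⟨hN, fun i => ?_⟩
  have h1 : ((-1 : ℤˣ)) ^ (i + N) = (-1) ^ i := by rw [pow_add, hE.neg_one_pow, mul_one]
  have h2 : entrySide X h (i + N) = entrySide X h i := by
    rw [entrySide, entrySide, hper]
    simp only [Nat.even_add, hE, iff_true]
  exact ⟨by simp only [ofLevels, h1, h2, hper], h1⟩

/-! ### The first return map on levels -/

/-- The level after crossing the table, starting from level `g`. -/
def halfReturn (X g : ℝ) : ℝ := 2 * midLevel X (outSide X g) - g

/-- The level of the next visit to the table, starting from level `g`. -/
def levelReturn (X g : ℝ) : ℝ :=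
  2 * midLevel X (inSide X (halfReturn X g)) - halfReturn X g

/-- `k` generic steps of the first return map to the table lead from level `g` to level `g'`. -/
def Runs (X : ℝ) (k : ℕ) (g g' : ℝ) : Prop :=
  (levelReturn X)^[k] g = g' ∧ ∀ n < k, Generic X ((levelReturn X)^[n] g) ∧
    Generic X (halfReturn X ((levelReturn X)^[n] g))

lemma runs_zero (X g : ℝ) : Runs X 0 g g := ⟨rfl, fun n hn => absurd hn (Nat.not_lt_zero n)⟩

lemma Runs.trans {X : ℝ} {k l : ℕ} {g g' g'' : ℝ} (h : Runs X k g g') (h' : Runs X l g' g'') :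
    Runs X (k + l) g g'' := by
  refine ⟨by rw [add_comm, Function.iterate_add_apply, h.1, h'.1], fun n hn => ?_⟩
  by_cases hk : n < k
  · exact h.2 n hk
  · obtain ⟨m, rfl⟩ := Nat.exists_eq_add_of_le (not_lt.1 hk)
    rw [add_comm k m, Function.iterate_add_apply, h.1]
    exact h'.2 m (by omega)

lemma Runs.exists_trajectory {X y : ℝ} (hX : 0 < X) (hy : 0 < y) {M : ℕ} {g : ℝ} (hM : 0 < M)
    (h : Runs X M g g) : ∃ τ : SurfaceTrajectory (flowDir X y), τ.ClosesAfter (2 * M) := by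
  have hmod : ∀ n, (levelReturn X)^[n % M] g = (levelReturn X)^[n] g := fun n =>
    Function.IsPeriodicPt.iterate_mod_apply (f := levelReturn X) h.1 n
  have hgen : ∀ n, Generic X ((levelReturn X)^[n] g) ∧
      Generic X (halfReturn X ((levelReturn X)^[n] g)) := fun n => by
    rw [← hmod]
    exact h.2 _ (Nat.mod_lt _ hM)
  let s : ℕ → ℝ := fun i => if Even i then (levelReturn X)^[i / 2] g
    else halfReturn X ((levelReturn X)^[i / 2] g)
  have hg : ∀ i, Generic X (s i) := fun i => by
    by_cases hi : Even i
    · simp only [s, if_pos hi]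
      exact (hgen _).1
    · simp only [s, if_neg hi]
      exact (hgen _).2
  have hs : ∀ i, s (i + 1) = 2 * midLevel X (exitSide X s i) - s i := fun i => by
    by_cases hi : Even i
    · have h1 : ¬ Even (i + 1) := by simpa [Nat.even_add_one] using hi
      have h2 : (i + 1) / 2 = i / 2 := by
        obtain ⟨k, rfl⟩ := hi
        omega
      simp only [exitSide, if_pos hi, s, if_neg h1, h2, halfReturn]
    · have h1 : Even (i + 1) := by simpa [Nat.even_add_one] using hi
      have h2 : (i + 1) / 2 = i / 2 + 1 := by
        obtain ⟨k, rfl⟩ := Nat.not_even_iff_odd.1 hi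
        omega
      simp only [exitSide, if_neg hi, s, if_pos h1, h2, Function.iterate_succ_apply', levelReturn]
  refine ⟨ofLevels hX hy s hg hs, ofLevels_closesAfter hX hy s hg hs (by omega)
    (even_two_mul M) fun i => ?_⟩
  have h1 : (i + 2 * M) / 2 = i / 2 + M := by omega
  have h2 : (levelReturn X)^[i / 2 + M] g = (levelReturn X)^[i / 2] g := by
    rw [Function.iterate_add_apply, h.1]
  simp only [s, h1, h2, Nat.even_add, even_two_mul, iff_true]

lemma runs_one {X g : ℝ} (hg : Generic X g) (hg' : Generic X (halfReturn X g)) :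
    Runs X 1 g (levelReturn X g) :=
  ⟨rfl, fun n hn => by
    obtain rfl : n = 0 := by omega
    exact ⟨hg, hg'⟩⟩

section

variable {X g : ℝ}

lemma halfReturn_low (h : g < φ * X + 1) : halfReturn X g = φ * X + 1 - g := by
  rw [halfReturn, outSide, if_pos h]
  simp only [midLevel, Matrix.cons_val]
  ring

lemma halfReturn_high (h : φ * X + 1 < g) :
    halfReturn X g = 2 * (φ * X + 1) + (X + φ) - g := by
  rw [halfReturn, outSide, if_neg h.not_gt]
  simp only [midLevel, Matrix.cons_val]
  ring

/-- The return map exchanges four intervals, cut at `φ * X`, `φ * X + 1` and `φ * X + X + 1`. This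
lemma and the next three are its branches, named after the two sides crossed; the inequations keep
the orbit off the vertices. -/
lemma runs_one_four (hX : 0 < X) (h0 : 0 < g) (h1 : g ≠ 1) (h2 : g < φ * X) :
    Runs X 1 g (g + (φ + 1)) := by
  have hp := phi_pos
  have hh := halfReturn_low (X := X) (g := g) (by linarith)
  have hr : levelReturn X g = g + (φ + 1) := by
    rw [levelReturn, hh, inSide, if_neg (by linarith), if_pos (by linarith)]
    simp only [midLevel, Matrix.cons_val]
    ring
  rw [← hr]
  refine runs_one ⟨h0, by linarith, h1, by linarith, by linarith⟩ ?_
  rw [hh]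
  exact ⟨by linarith, by linarith, by linarith, by linarith, by linarith⟩

lemma runs_one_zero (hX : 0 < X) (h1 : g ≠ 1) (h2 : φ * X < g) (h3 : g < φ * X + 1) :
    Runs X 1 g (g - φ * X) := by
  have hp := phi_pos
  have hpX : 0 < φ * X := by positivity
  have hh := halfReturn_low (X := X) (g := g) h3
  have hr : levelReturn X g = g - φ * X := by
    rw [levelReturn, hh, inSide, if_pos (by linarith)]
    simp only [midLevel, Matrix.cons_val]
    ring
  rw [← hr]
  refine runs_one ⟨by linarith, by linarith, h1, by linarith, by linarith⟩ ?_
  rw [hh]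
  exact ⟨by linarith, by linarith, by linarith, by linarith, by linarith⟩

lemma runs_two_three (hX : 0 < X) (h1 : g ≠ φ * X + φ + 1) (h2 : φ * X + 1 < g)
    (h3 : g < φ * X + X + 1) : Runs X 1 g (g + φ) := by
  have hp := phi_pos
  have hpX : 0 < φ * X := by positivity
  have hh := halfReturn_high h2
  have hr : levelReturn X g = g + φ := by
    rw [levelReturn, hh, inSide, if_neg (by linarith), if_neg (by linarith)]
    simp only [midLevel, Matrix.cons_val]
    ring
  rw [← hr]
  refine runs_one ⟨by linarith, by linarith, by linarith, by linarith, h1⟩ ?_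
  rw [hh]
  exact ⟨by linarith, by linarith, by linarith, by linarith, by linarith⟩

lemma runs_two_four (hX : 0 < X) (h1 : g ≠ φ * X + φ + 1) (h2 : φ * X + X + 1 < g)
    (h3 : g < φ * X + φ + 1 + X) : Runs X 1 g (g - (φ * X + X)) := by
  have hp := phi_pos
  have hpX : 0 < φ * X := by positivity
  have hh := halfReturn_high (X := X) (g := g) (by linarith)
  have hr : levelReturn X g = g - (φ * X + X) := by
    rw [levelReturn, hh, inSide, if_neg (by linarith), if_pos (by linarith)]
    simp only [midLevel, Matrix.cons_val]
    ring
  rw [← hr]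
  refine runs_one ⟨by linarith, by linarith, by linarith, by linarith, h1⟩ ?_
  rw [hh]
  exact ⟨by linarith, by linarith, by linarith, by linarith, by linarith⟩

lemma runs_one_four_pow (hX : 0 < X) (h0 : 0 < g) (h1 : g ≠ 1) (k : ℕ)
    (h2 : g + k * (φ + 1) < φ * X + (φ + 1)) : Runs X k g (g + k * (φ + 1)) := by
  have hp := phi_pos
  induction k with
  | zero => simpa using runs_zero X g
  | succ k ih =>
    push_cast at h2
    have h3 := ih (by linarith)
    have hk : (0 : ℝ) ≤ k := Nat.cast_nonneg k
    have h4 : 0 ≤ k * (φ + 1) := by positivity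
    -- Only the initial level can equal 1; later ones exceed `φ + 1`.
    have h5 : g + k * (φ + 1) ≠ 1 := by
      rcases Nat.eq_zero_or_pos k with rfl | hk'
      · simpa using h1
      · have : (1 : ℝ) ≤ k := by exact_mod_cast hk'
        nlinarith
    have h6 := h3.trans (runs_one_four hX (by linarith) h5 (by linarith))
    convert h6 using 1
    push_cast
    ring

lemma runs_two_three_pow (hX : 0 < X) (h0 : φ * X + 1 < g) (h1 : g ≠ φ * X + φ + 1) (k : ℕ)
    (h2 : g + k * φ < φ * X + X + 1 + φ) : Runs X k g (g + k * φ) := by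
  have hp := phi_pos
  induction k with
  | zero => simpa using runs_zero X g
  | succ k ih =>
    push_cast at h2
    have h3 := ih (by linarith)
    have h4 : 0 ≤ k * φ := by positivity
    have h5 : g + k * φ ≠ φ * X + φ + 1 := by
      rcases Nat.eq_zero_or_pos k with rfl | hk'
      · simpa using h1
      · have : (1 : ℝ) ≤ k := by exact_mod_cast hk'
        nlinarith
    have h6 := h3.trans (runs_two_three hX h5 (by linarith) (by linarith))
    convert h6 using 1
    push_cast
    ring

end

/-! ### The tree directions -/

lemma treeVector_one (m : ℕ) :
    treeVector (1 :: List.replicate m 0) = ![φ * (m + 1), 1] := by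
  induction m with
  | zero => ext i; fin_cases i <;> simp [treeVector, sigma]
  | succ m ih =>
    rw [List.replicate_succ', ← List.cons_append]
    unfold treeVector at ih ⊢
    rw [List.foldl_append, ih]
    ext i
    fin_cases i <;> simp [sigma]
    ring

lemma treeVector_two (m : ℕ) :
    treeVector (2 :: List.replicate m 0) = ![φ * (1 + m * φ), φ] := by
  induction m with
  | zero => ext i; fin_cases i <;> simp [treeVector, sigma]
  | succ m ih =>
    rw [List.replicate_succ', ← List.cons_append]
    unfold treeVector at ih ⊢
    rw [List.foldl_append, ih]
    ext i
    fin_cases i <;> simp [sigma]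
    ring

lemma treeDirection_one (m : ℕ) :
    treeDirection (1 :: List.replicate m 0) = flowDir (φ * (m + 1)) 1 := by
  unfold treeDirection
  rw [treeVector_one, flowDir, matrixP, cos_fifth, ← sn]
  apply Complex.ext <;> simp [Matrix.mulVec, dotProduct]

/-- Taking the factor `φ` out as `y` leaves `X = 1 + m * φ` in `ℕ[φ]`, as `phi_coords` needs. -/
lemma treeDirection_two (m : ℕ) :
    treeDirection (2 :: List.replicate m 0) = flowDir (1 + m * φ) φ := by
  unfold treeDirection
  rw [treeVector_two, flowDir, matrixP, cos_fifth, ← sn]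
  apply Complex.ext <;> simp [Matrix.mulVec, dotProduct] <;> ring

/-- The coordinates of an element of `ℕ[φ]` are unique. -/
lemma phi_coords {a b c d : ℕ} (h : a * φ + b = c * φ + d) : a = c ∧ b = d := by
  have h1 : ((a : ℤ) - c : ℤ) * φ = ((d : ℤ) - b : ℤ) := by
    push_cast
    linarith
  have h2 : (a : ℤ) - c = 0 := by
    by_contra hne
    have h3 : Irrational (((a : ℤ) - c : ℤ) * φ) :=
      Real.goldenRatio_irrational.intCast_mul hne
    rw [h1] at h3
    exact h3.ne_int _ rfl
  have h3 : a = c := by omega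
  refine ⟨h3, ?_⟩
  subst h3
  exact_mod_cast add_left_cancel h

namespace SurfaceTrajectory

lemma exists_sheet_eq_one {u : ℂ} (τ : SurfaceTrajectory u) : ∃ i, τ.sheet i = 1 := by
  rcases Int.units_eq_one_or (τ.sheet 0) with h | h
  · exact ⟨0, h⟩
  · exact ⟨1, by rw [τ.sheet_succ, h, neg_neg]⟩

lemma folds_of_angle {X y : ℝ} {τ : SurfaceTrajectory (flowDir X y)} (hX : 0 < X) (hy : 0 < y)
    {N : ℕ} (hN : IsLeast {M | τ.ClosesAfter M} N)
    (ha : ∀ i, τ.sheet i = 1 → τ.angle i N ≠ 0) :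
    (∃ B, τ.FoldsTo B) ∧
      ∀ B, τ.FoldsTo B → B.RotationallySymmetric ∧ B.HasPeriod (5 * N) := by
  refine ⟨τ.exists_foldsTo, fun B hB => ?_⟩
  obtain ⟨i, hi, rfl⟩ := hB.exists_eq_fold
  refine fold_period hN (fun M hM => τ.fold_not_repeatsAfter_odd (fun j => ?_) hM) (ha i hi)
  rw [inner_flowDir]
  exact mul_ne_zero (mul_pos hy sn_pos).ne' (levelSpan_ne_zero hX j)

lemma length_coords {X y : ℝ} (hy : 0 < y) {c d c' d' : ℕ}
    (h : (d + φ * c) * unitLength X y = (d' + φ * c') * unitLength X y) : c = c' ∧ d = d' := by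
  have h1 := mul_right_cancel₀ (unitLength_pos hy).ne' h
  exact phi_coords (by linarith)

/-! ### The directions with tree words `1 0 ⋯ 0` -/

section

variable {m : ℕ} {X y : ℝ}

/-- For `X = φ(m + 1)` the closing equation reads `aφ + b = (m + 1)((c + d)φ + c)`, which determines
`a` and `b`. -/
lemma counts_one (hX : X = φ * (m + 1)) (hy : 0 < y) {τ : SurfaceTrajectory (flowDir X y)}
    {N : ℕ} (h : τ.ClosesAfter N) :
    ∃ c d : ℕ, N = 2 * ((c + d) * (m + 2) + c * (m + 1)) ∧
      ∑ k ∈ Finset.range N, τ.time k * ‖flowDir X y‖ = (d + φ * c) * unitLength X y ∧ 0 < c + d ∧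
      ∀ i, τ.sheet i = 1 →
        (τ.angle i N : ℕ) = (4 * ((c + d) * (m + 1)) + 3 * (c * (m + 1)) + c + 2 * d) % 5 := by
  have hp := phi_pos
  have hX0 : 0 < X := by
    rw [hX]
    positivity
  have key : ∀ i, τ.sheet i = 1 →
    ∃ c d : ℕ, N = 2 * ((c + d) * (m + 2) + c * (m + 1)) ∧
      ∑ k ∈ Finset.range N, τ.time k * ‖flowDir X y‖ = (d + φ * c) * unitLength X y ∧ 0 < c + d ∧
        (τ.angle i N : ℕ) =
          (4 * ((c + d) * (m + 1)) + 3 * (c * (m + 1)) + c + 2 * d) % 5 := fun i hi => by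
    obtain ⟨a, b, c, d, h1, h2, h3, h4, -, h6⟩ := h.exists_counts hX0 hy hi
    have h7 : (a : ℝ) * φ + b = ((c + d) * (m + 1) : ℕ) * φ + (c * (m + 1) : ℕ) := by
      rw [h2, hX]
      push_cast
      linear_combination (c * (m + 1)) * phi_sq
    obtain ⟨rfl, rfl⟩ := phi_coords h7
    exact ⟨c, d, by rw [h1]; ring, h4, h6, h3⟩
  -- The length determines `(c, d)`, so one pair serves every starting index.
  obtain ⟨i, hi⟩ := τ.exists_sheet_eq_one
  obtain ⟨c, d, h1, h2, h3, -⟩ := key i hi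
  refine ⟨c, d, h1, h2, h3, fun i hi => ?_⟩
  obtain ⟨c', d', -, h2', -, h4'⟩ := key i hi
  obtain ⟨rfl, rfl⟩ := length_coords hy (h2.symm.trans h2')
  exact h4'

lemma unitLength_le_one (hX : X = φ * (m + 1)) (hy : 0 < y) (τ : SurfaceTrajectory (flowDir X y))
    (l : ℝ) (hl : τ.HasLength l) : unitLength X y ≤ l := by
  obtain ⟨N, hN, rfl⟩ := hl
  obtain ⟨c, d, -, h2, h3, -⟩ := counts_one hX hy hN.1
  rw [h2]
  have h4 : (1 : ℝ) ≤ d + φ * c := by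
    have h5 : (1 : ℝ) ≤ c + d := by exact_mod_cast h3
    have h6 : (0 : ℝ) ≤ c := Nat.cast_nonneg c
    nlinarith [lt_phi]
  nlinarith [unitLength_pos (X := X) hy]

/-- From level `1/2`, `m + 1` steps of type (1, 4) climb by `(m + 1)φ² = φX`, and one step of type
(1, 0) comes back. Minimality of `N` then leaves only `c = 0`, `d = 1`. -/
lemma exists_short_one (hX : X = φ * (m + 1)) (hy : 0 < y) :
    ∃ τ : SurfaceTrajectory (flowDir X y), τ.HasLength (unitLength X y) := by
  have hp := phi_pos
  have hX0 : 0 < X := by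
    rw [hX]
    positivity
  have hφX : φ * X = (m + 1 : ℕ) * (φ + 1) := by
    rw [hX]
    push_cast
    linear_combination (m + 1 : ℝ) * phi_sq
  have r1 := runs_one_four_pow (g := 1 / 2) hX0 (by norm_num) (by norm_num) (m + 1)
    (by rw [hφX]; linarith)
  have hpos : 1 < φ * X := by
    rw [hφX]
    push_cast
    nlinarith [(Nat.cast_nonneg m : (0 : ℝ) ≤ m)]
  rw [← hφX] at r1
  have r2 := runs_one_zero (g := 1 / 2 + φ * X) hX0 (by linarith) (by linarith) (by linarith)
  rw [add_sub_cancel_right] at r2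
  obtain ⟨τ, hτ⟩ := (r1.trans r2).exists_trajectory hX0 hy (by omega)
  obtain ⟨N, hN⟩ := exists_isLeast hτ
  refine ⟨τ, N, hN, ?_⟩
  obtain ⟨c, d, h1, h2, h3, -⟩ := counts_one hX hy hN.1
  have hle : N ≤ 2 * (m + 1 + 1) := hN.2 hτ
  have h4 : c + d = 1 := by
    by_contra hne
    have h5 : 2 ≤ c + d := by omega
    nlinarith
  have h5 : c = 0 := by
    rw [h4] at h1
    by_contra hc
    have : 1 ≤ c := Nat.pos_of_ne_zero hc
    nlinarith
  obtain rfl : d = 1 := by omega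
  rw [h2, h5]
  simp

/-- Any start in `(1, φ + 1)`, such as 2, climbs by `φX` in `m + 1` steps (1, 4), then by `X` in `m
+ 1` steps (2, 3), and one step (2, 4) comes back. -/
lemma exists_long_one (hX : X = φ * (m + 1)) (hy : 0 < y) :
    ∃ τ : SurfaceTrajectory (flowDir X y), τ.HasLength (φ * unitLength X y) := by
  have hp := phi_pos
  have hp1 := lt_phi
  have hp2 := phi_lt
  have hX1 : φ ≤ X := by
    rw [hX]
    nlinarith [(Nat.cast_nonneg m : (0 : ℝ) ≤ m)]
  have hX0 : 0 < X := by linarith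
  have hφX : φ * X = (m + 1 : ℕ) * (φ + 1) := by
    rw [hX]
    push_cast
    linear_combination (m + 1 : ℝ) * phi_sq
  have hX' : X = (m + 1 : ℕ) * φ := by
    rw [hX]
    push_cast
    ring
  have r1 := runs_one_four_pow (g := 2) hX0 (by norm_num) (by norm_num) (m + 1)
    (by rw [hφX]; linarith)
  have r2 := runs_two_three_pow (g := 2 + φ * X) hX0 (by linarith) (fun h => by linarith) (m + 1)
    (by rw [← hX']; linarith)
  rw [← hφX] at r1
  rw [← hX'] at r2
  have r3 := runs_two_four (g := 2 + φ * X + X) hX0 (fun h => by linarith) (by linarith)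
    (by linarith)
  rw [add_assoc, add_sub_cancel_right, ← add_assoc] at r3
  obtain ⟨τ, hτ⟩ := ((r1.trans r2).trans r3).exists_trajectory hX0 hy (by omega)
  obtain ⟨N, hN⟩ := exists_isLeast hτ
  refine ⟨τ, N, hN, ?_⟩
  obtain ⟨c, d, h1, h2, h3, -⟩ := counts_one hX hy hN.1
  obtain ⟨q, hq⟩ := dvd_of_closesAfter hN hτ
  have h4 : 2 * m + 3 = ((c + d) * (m + 2) + c * (m + 1)) * q := by
    rw [h1, mul_assoc] at hq
    omega
  have hq0 : 0 < q := by
    rcases Nat.eq_zero_or_pos q with rfl | h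
    · simp at h4
    · exact h
  have h5 : c + d = 1 := by
    by_contra hne
    have h6 : 2 ≤ c + d := by omega
    nlinarith [Nat.le_mul_of_pos_right ((c + d) * (m + 2) + c * (m + 1)) hq0]
  -- With `c = 0` the least period would be that of a short trajectory, and `m + 2` would divide `2
  -- * m + 3`.
  have h6 : c = 1 := by
    by_contra hc
    obtain rfl : c = 0 := by omega
    rw [h5, zero_mul, one_mul, add_zero] at h4
    have h7 : m + 2 ∣ 1 := by
      have h8 : m + 2 ∣ 2 * m + 3 := ⟨q, h4⟩
      have h9 : m + 2 ∣ (2 * m + 3) + 1 := ⟨2, by ring⟩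
      exact (Nat.dvd_add_right h8).1 h9
    have := Nat.le_of_dvd one_pos h7
    omega
  obtain rfl : d = 0 := by omega
  rw [h2, h6]
  simp

lemma isShort_of_hasLength_one (hX : X = φ * (m + 1)) (hy : 0 < y)
    {τ : SurfaceTrajectory (flowDir X y)} (h : τ.HasLength (unitLength X y)) : τ.IsShort :=
  ⟨_, h, unitLength_le_one hX hy⟩

lemma IsShort.eq_unitLength_one (hX : X = φ * (m + 1)) (hy : 0 < y)
    {τ : SurfaceTrajectory (flowDir X y)} {l : ℝ}
    (hmin : ∀ (τ' : SurfaceTrajectory (flowDir X y)) (l' : ℝ), τ'.HasLength l' → l ≤ l')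
    (h : τ.HasLength l) : l = unitLength X y := by
  obtain ⟨τ', h'⟩ := exists_short_one hX hy
  exact le_antisymm (hmin _ _ h') (unitLength_le_one hX hy τ l h)

lemma HasLength.unique {u : ℂ} {τ : SurfaceTrajectory u} {l l' : ℝ} (h : τ.HasLength l)
    (h' : τ.HasLength l') : l = l' := by
  obtain ⟨N, hN, rfl⟩ := h
  obtain ⟨N', hN', rfl⟩ := h'
  rw [hN.unique hN']

theorem short_one (hX : X = φ * (m + 1)) (hy : 0 < y) (hm : m % 5 ≠ 1) :
    (∃ τ : SurfaceTrajectory (flowDir X y), τ.IsShort) ∧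
    ∀ τ : SurfaceTrajectory (flowDir X y), τ.IsShort → (∃ B, τ.FoldsTo B) ∧
      ∀ B, τ.FoldsTo B → B.RotationallySymmetric ∧ B.HasPeriod (10 * (m + 2)) := by
  have hX0 : 0 < X := by
    rw [hX]
    have := phi_pos
    positivity
  refine ⟨?_, fun τ hτ => ?_⟩
  · obtain ⟨τ, h⟩ := exists_short_one hX hy
    exact ⟨τ, isShort_of_hasLength_one hX hy h⟩
  · obtain ⟨l, hl, hmin⟩ := hτ
    obtain rfl := IsShort.eq_unitLength_one hX hy hmin hl
    obtain ⟨N, hN, hlen⟩ := hl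
    obtain ⟨c, d, h1, h2, h3, h4⟩ := counts_one hX hy hN.1
    obtain ⟨rfl, rfl⟩ : c = 0 ∧ d = 1 :=
      length_coords hy (h2.symm.trans (hlen.symm.trans (by simp)))
    -- The rotation is `4(m + 1) + 2`, which vanishes mod 5 exactly for `m ≡ 1`.
    have h5 := folds_of_angle hX0 hy hN fun i hi h0 => by
      have h6 := h4 i hi
      rw [h0] at h6
      simp at h6
      omega
    rw [h1, show 5 * (2 * ((0 + 1) * (m + 2) + 0 * (m + 1))) =
      10 * (m + 2) by ring] at h5
    exact h5

theorem long_one (hX : X = φ * (m + 1)) (hy : 0 < y) (hm : m % 5 = 0) :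
    (∃ τ : SurfaceTrajectory (flowDir X y), τ.IsLong) ∧
    ∀ τ : SurfaceTrajectory (flowDir X y), τ.IsLong → (∃ B, τ.FoldsTo B) ∧
      ∀ B, τ.FoldsTo B → B.RotationallySymmetric ∧ B.HasPeriod (10 * (2 * m + 3)) := by
  have hX0 : 0 < X := by
    rw [hX]
    have := phi_pos
    positivity
  refine ⟨?_, fun τ hτ => ?_⟩
  · obtain ⟨τ, h⟩ := exists_long_one hX hy
    obtain ⟨τ', h'⟩ := exists_short_one hX hy
    exact ⟨τ, τ', _, isShort_of_hasLength_one hX hy h', h', h⟩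
  · obtain ⟨τ', l, ⟨l', hl', hmin⟩, hl, hτ⟩ := hτ
    obtain rfl := hl.unique hl'
    obtain rfl := IsShort.eq_unitLength_one hX hy hmin hl
    obtain ⟨N, hN, hlen⟩ := hτ
    obtain ⟨c, d, h1, h2, h3, h4⟩ := counts_one hX hy hN.1
    obtain ⟨rfl, rfl⟩ : c = 1 ∧ d = 0 :=
      length_coords hy (h2.symm.trans (hlen.symm.trans (by simp)))
    -- The rotation is `7(m + 1) + 1`, which is 3 mod 5 when `5 ∣ m`.
    have h5 := folds_of_angle hX0 hy hN fun i hi h0 => by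
      have h6 := h4 i hi
      rw [h0] at h6
      simp at h6
      omega
    rw [h1, show 5 * (2 * ((1 + 0) * (m + 2) + 1 * (m + 1))) =
      10 * (2 * m + 3) by ring] at h5
    exact h5

/-! ### The directions with tree words `2 0 ⋯ 0` -/

lemma counts_two (hX : X = 1 + m * φ) (hy : 0 < y) {τ : SurfaceTrajectory (flowDir X y)}
    {N : ℕ} (h : τ.ClosesAfter N) :
    ∃ c d : ℕ, N = 2 * (c * (2 * m + 2) + d * (m + 2)) ∧
      ∑ k ∈ Finset.range N, τ.time k * ‖flowDir X y‖ = (d + φ * c) * unitLength X y ∧ 0 < c ∧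
      ∀ i, τ.sheet i = 1 →
        (τ.angle i N : ℕ) = (4 * (c + c * m + d * m) + 3 * (c * m + d) + c + 2 * d) % 5 := by
  have hp := phi_pos
  have hX0 : 0 < X := by
    rw [hX]
    positivity
  have key : ∀ i, τ.sheet i = 1 →
    ∃ c d : ℕ, N = 2 * (c * (2 * m + 2) + d * (m + 2)) ∧
      ∑ k ∈ Finset.range N, τ.time k * ‖flowDir X y‖ = (d + φ * c) * unitLength X y ∧ 0 < c ∧
        (τ.angle i N : ℕ) =
          (4 * (c + c * m + d * m) + 3 * (c * m + d) + c + 2 * d) % 5 := fun i hi => by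
    obtain ⟨a, b, c, d, h1, h2, h3, h4, h5, h6⟩ := h.exists_counts hX0 hy hi
    have h7 : (a : ℝ) * φ + b = (c + c * m + d * m : ℕ) * φ + (c * m + d : ℕ) := by
      rw [h2, hX]
      push_cast
      linear_combination (c * m) * phi_sq
    obtain ⟨rfl, rfl⟩ := phi_coords h7
    refine ⟨c, d, by rw [h1]; ring, h4, ?_, h3⟩
    -- If `c = 0`, then `b = c * m + d` vanishes, hence `d = 0` too. So no trajectory has length
    -- `unitLength`, and the short ones have `c = 1`, `d = 0`.
    rcases Nat.eq_zero_or_pos c with hc | hc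
    · have := h5 hc
      omega
    · exact hc
  obtain ⟨i, hi⟩ := τ.exists_sheet_eq_one
  obtain ⟨c, d, h1, h2, h3, -⟩ := key i hi
  refine ⟨c, d, h1, h2, h3, fun i hi => ?_⟩
  obtain ⟨c', d', -, h2', -, h4'⟩ := key i hi
  obtain ⟨rfl, rfl⟩ := length_coords hy (h2.symm.trans h2')
  exact h4'

lemma unitLength_le_two (hX : X = 1 + m * φ) (hy : 0 < y) (τ : SurfaceTrajectory (flowDir X y))
    (l : ℝ) (hl : τ.HasLength l) : φ * unitLength X y ≤ l := by
  obtain ⟨N, hN, rfl⟩ := hl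
  obtain ⟨c, d, -, h2, h3, -⟩ := counts_two hX hy hN.1
  rw [h2]
  have h4 : φ ≤ d + φ * c := by
    have h5 : (1 : ℝ) ≤ c := by exact_mod_cast h3
    have h6 : (0 : ℝ) ≤ d := Nat.cast_nonneg d
    nlinarith [phi_pos]
  nlinarith [unitLength_pos (X := X) hy]

/-- Any start in `(1, φ)`, such as `3/2`, works: `m + 1` steps (1, 4) climb by `φX + 1`, `m` steps
(2, 3) by `X - 1`, and one step (2, 4) comes back. -/
lemma exists_short_two (hX : X = 1 + m * φ) (hy : 0 < y) :
    ∃ τ : SurfaceTrajectory (flowDir X y), τ.HasLength (φ * unitLength X y) := by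
  have hp := phi_pos
  have hp1 := lt_phi
  have hp2 := phi_lt
  have hX0 : 0 < X := by
    rw [hX]
    positivity
  have hφX : φ * X = φ + m * (φ + 1) := by
    rw [hX]
    linear_combination (m : ℝ) * phi_sq
  have r1 := runs_one_four_pow (g := 3 / 2) hX0 (by norm_num) (by norm_num) (m + 1)
    (by rw [hφX]; push_cast; linarith)
  have r2 := runs_two_three_pow (g := 5 / 2 + φ * X) hX0 (by linarith) (fun h => by linarith) m
    (by linarith)
  have e1 : 3 / 2 + ((m + 1 : ℕ) : ℝ) * (φ + 1) = 5 / 2 + φ * X := by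
    rw [hφX]
    push_cast
    ring
  have e2 : 5 / 2 + φ * X + m * φ = 3 / 2 + (φ * X + X) := by
    linarith
  rw [e1] at r1
  rw [e2] at r2
  have hne : 3 / 2 + (φ * X + X) ≠ φ * X + φ + 1 := by
    intro h
    rcases Nat.eq_zero_or_pos m with rfl | hm
    · simp at hX
      linarith
    · have : (1 : ℝ) ≤ m := by exact_mod_cast hm
      nlinarith
  have r3 := runs_two_four (g := 3 / 2 + (φ * X + X)) hX0 hne (by linarith) (by linarith)
  rw [add_sub_cancel_right] at r3
  obtain ⟨τ, hτ⟩ := ((r1.trans r2).trans r3).exists_trajectory hX0 hy (by omega)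
  obtain ⟨N, hN⟩ := exists_isLeast hτ
  refine ⟨τ, N, hN, ?_⟩
  obtain ⟨c, d, h1, h2, h3, -⟩ := counts_two hX hy hN.1
  have hle : N ≤ 2 * (m + 1 + m + 1) := hN.2 hτ
  have h5 : c = 1 := by
    by_contra hne
    have h6 : 2 ≤ c := by omega
    nlinarith [Nat.zero_le (d * (m + 2))]
  subst h5
  have h6 : d = 0 := by
    by_contra hd
    have h7 : 1 ≤ d := Nat.pos_of_ne_zero hd
    nlinarith
  rw [h2, h6]
  simp

theorem short_two (hX : X = 1 + m * φ) (hy : 0 < y) (hm : m % 5 ≠ 0) :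
    (∃ τ : SurfaceTrajectory (flowDir X y), τ.IsShort) ∧
    ∀ τ : SurfaceTrajectory (flowDir X y), τ.IsShort → (∃ B, τ.FoldsTo B) ∧
      ∀ B, τ.FoldsTo B → B.RotationallySymmetric ∧ B.HasPeriod (10 * (2 * m + 2)) := by
  have hX0 : 0 < X := by
    rw [hX]
    have := phi_pos
    positivity
  obtain ⟨τ₀, h₀⟩ := exists_short_two hX hy
  refine ⟨⟨τ₀, _, h₀, unitLength_le_two hX hy⟩, fun τ hτ => ?_⟩
  obtain ⟨l, hl, hmin⟩ := hτ
  obtain rfl := le_antisymm (hmin _ _ h₀) (unitLength_le_two hX hy τ l hl)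
  obtain ⟨N, hN, hlen⟩ := hl
  obtain ⟨c, d, h1, h2, h3, h4⟩ := counts_two hX hy hN.1
  obtain ⟨rfl, rfl⟩ : c = 1 ∧ d = 0 :=
    length_coords hy (h2.symm.trans (hlen.symm.trans (by simp)))
  -- The rotation is `4(m + 1) + 3m + 1`, that is `2m` mod 5.
  have h5 := folds_of_angle hX0 hy hN fun i hi h0 => by
    have h6 := h4 i hi
    rw [h0] at h6
    simp at h6
    omega
  rw [h1, show 5 * (2 * (1 * (2 * m + 2) + 0 * (m + 2))) =
    10 * (2 * m + 2) by ring] at h5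
  exact h5

end

end SurfaceTrajectory

/-! ### A trajectory of period ten -/

/-- Trajectories on the double pentagon that are parallel to a side. -/
def horizontal : SurfaceTrajectory 1 where
  sheet i := (-1) ^ i
  -- The offset `sn / 2` avoids the midpoints, where the entry points on the two sheets would be
  -- complex conjugate and odd repetition could not be excluded.
  entry i := if Even i then normal 4 + (sn / 2) • zeta ^ 4 else -(normal 1 + (sn / 2) • zeta ^ 1)
  side i := if Even i then 4 else 1
  time i := if Even i then 2 * (φ * sn) - sn / 2 * (φ - 1) else 2 * (φ * sn) + sn / 2 * (φ - 1)
  entry_mem i := by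
    have h1 := sn_pos
    have h2 : |sn / 2| < 2 * sn * (φ - 1) := by
      rw [abs_of_pos (by positivity)]
      nlinarith [lt_phi]
    by_cases hi : Even i
    · simp only [if_pos hi, OnSide, hi.neg_one_pow]
      exact (mem_openSide_iff _ _).2 ⟨sn / 2, h2, by simp⟩
    · simp only [if_neg hi, OnSide, (Nat.not_even_iff_odd.1 hi).neg_one_pow]
      exact (mem_openSide_iff _ _).2 ⟨sn / 2, h2, by simp [add_comm]⟩
  inward i := by
    have h1 := sn_pos
    have h2 := phi_pos
    by_cases hi : Even i
    · simp only [if_pos hi, hi.neg_one_pow, sheetNormal_one, normal_four, inner_eq]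
      simp
      positivity
    · simp only [if_neg hi, (Nat.not_even_iff_odd.1 hi).neg_one_pow, sheetNormal_neg_one,
        normal_one, inner_eq]
      simp
      positivity
  time_pos i := by
    have h1 := sn_pos
    have h2 := lt_phi
    split_ifs <;> nlinarith
  exit_mem i := by
    have h1 := sn_pos
    have h2 : |-(sn / 2)| < 2 * sn * (φ - 1) := by
      rw [abs_neg, abs_of_pos (by positivity)]
      nlinarith [lt_phi]
    by_cases hi : Even i
    · have hi' : ¬ Even (i + 1) := by simpa [Nat.even_add_one] using hi
      simp only [if_pos hi, if_neg hi', OnSide, hi.neg_one_pow]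
      refine (mem_openSide_iff _ _).2 ⟨-(sn / 2), h2, ?_⟩
      rw [normal_four, normal_one, zeta_pow_four, Fin.val_one, pow_one, zeta_eq]
      apply Complex.ext <;> simp <;> ring
    · have hi' : Even (i + 1) := by simpa [Nat.even_add_one] using hi
      simp only [if_neg hi, if_pos hi', OnSide, (Nat.not_even_iff_odd.1 hi).neg_one_pow]
      refine (mem_openSide_iff _ _).2 ⟨-(sn / 2), h2, ?_⟩
      rw [normal_four, normal_one, show ((4 : Fin 5) : ℕ) = 4 from rfl, zeta_pow_four, pow_one,
        zeta_eq]
      apply Complex.ext <;> simp <;> ring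
  glue i := by
    by_cases hi : Even i
    · have hi' : ¬ Even (i + 1) := by simpa [Nat.even_add_one] using hi
      simp only [if_pos hi, if_neg hi', hi.neg_one_pow, sheetNormal_one]
      rw [normal_four, normal_one, zeta_pow_four, pow_one, zeta_eq]
      apply Complex.ext <;> simp <;> ring
    · have hi' : Even (i + 1) := by simpa [Nat.even_add_one] using hi
      simp only [if_neg hi, if_pos hi', (Nat.not_even_iff_odd.1 hi).neg_one_pow,
        sheetNormal_neg_one]
      rw [normal_four, normal_one, zeta_pow_four, pow_one, zeta_eq]
      apply Complex.ext <;> simp <;> ring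
  sheet_succ i := by rw [pow_succ, mul_neg_one]

lemma horizontal_isLeast : IsLeast {M | horizontal.ClosesAfter M} 2 := by
  have h2 : ∀ i, Even (i + 2) ↔ Even i := fun i => by simp [Nat.even_add]
  refine ⟨⟨by norm_num, fun i => ⟨?_, ?_⟩⟩, fun M hM => ?_⟩
  · simp only [horizontal, h2]
  · simp [horizontal, pow_add]
  · obtain ⟨k, hk⟩ := SurfaceTrajectory.ClosesAfter.even hM
    have := hM.1
    omega

lemma horizontal_fold_odd {M : ℕ} (hM : Odd M) : ¬ (horizontal.fold 0).RepeatsAfter M := by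
  intro h
  have hE : ¬ Even M := Nat.not_even_iff_odd.2 hM
  obtain ⟨h1, h2⟩ := h.2 0
  simp only [SurfaceTrajectory.fold, zero_add, horizontal, foldMap, hM.neg_one_pow, if_neg hE,
    if_neg neg_one_ne_one_units, pow_zero, if_true, SurfaceTrajectory.angle, map_one,
    Fin.val_zero, one_mul, mul_one, Even.zero] at h1 h2
  rw [h2, one_mul, normal_one, normal_four, zeta_pow_four, pow_one, zeta_eq] at h1
  have h3 := congrArg Complex.im h1
  simp only [Complex.conj_im, Complex.neg_im, Complex.add_im, Complex.smul_im, smul_eq_mul] at h3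
  nlinarith [sn_pos, phi_pos, mul_pos phi_pos (mul_pos sn_pos sn_pos)]

theorem exists_period_ten :
    ∃ B : BilliardTrajectory, B.RotationallySymmetric ∧ B.HasPeriod 10 := by
  refine ⟨horizontal.fold 0, SurfaceTrajectory.fold_period (N := 2) horizontal_isLeast
    (fun M hM => horizontal_fold_odd hM) ?_⟩
  -- The rotation after the two crossings is `2 * 1 - 2 * 4`, which is 4 mod 5.
  simp [SurfaceTrajectory.angle, horizontal, stepAngle]

/-! ### From the tree directions to all multiples of ten -/

lemma TreeTrajectoriesSymmetricOfPeriod.exists_billiard {w : List (Fin 4)}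
    {K : SurfaceTrajectory (treeDirection w) → Prop} {N : ℕ}
    (h : TreeTrajectoriesSymmetricOfPeriod w K N) :
    ∃ B : BilliardTrajectory, B.RotationallySymmetric ∧ B.HasPeriod N := by
  obtain ⟨⟨τ, hτ⟩, h'⟩ := h
  obtain ⟨⟨B, hB⟩, hall⟩ := h' τ hτ
  exact ⟨B, hall B hB⟩

lemma treeTrajectories_short_one {k : ℕ} (hk : 2 ≤ k) (h : k % 5 ≠ 3) :
    TreeTrajectoriesSymmetricOfPeriod (1 :: List.replicate (k - 2) 0)
      SurfaceTrajectory.IsShort (10 * k) := by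
  obtain ⟨m, rfl⟩ := Nat.exists_eq_add_of_le' hk
  rw [Nat.add_sub_cancel]
  unfold TreeTrajectoriesSymmetricOfPeriod
  rw [treeDirection_one]
  exact SurfaceTrajectory.short_one rfl one_pos (by omega)

lemma treeTrajectories_long_one {k : ℕ} (h : k % 10 = 3) :
    TreeTrajectoriesSymmetricOfPeriod (1 :: List.replicate ((k - 3) / 2) 0)
      SurfaceTrajectory.IsLong (10 * k) := by
  obtain ⟨m, rfl⟩ : ∃ m, k = 2 * m + 3 := ⟨(k - 3) / 2, by omega⟩
  rw [show (2 * m + 3 - 3) / 2 = m by omega]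
  unfold TreeTrajectoriesSymmetricOfPeriod
  rw [treeDirection_one]
  exact SurfaceTrajectory.long_one rfl one_pos (by omega)

lemma treeTrajectories_short_two {k : ℕ} (h : k % 10 = 8) :
    TreeTrajectoriesSymmetricOfPeriod (2 :: List.replicate ((k - 2) / 2) 0)
      SurfaceTrajectory.IsShort (10 * k) := by
  obtain ⟨m, rfl⟩ : ∃ m, k = 2 * m + 2 := ⟨(k - 2) / 2, by omega⟩
  rw [show (2 * m + 2 - 2) / 2 = m by omega]
  unfold TreeTrajectoriesSymmetricOfPeriod
  rw [treeDirection_two]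
  exact SurfaceTrajectory.short_two rfl phi_pos (by omega)

end

end PentagonBilliards

open PentagonBilliards in
theorem exists_symmetric_of_ten_dvd {n : ℕ} (hn : 0 < n) (h : 10 ∣ n) :
    ∃ B : BilliardTrajectory, B.RotationallySymmetric ∧ B.HasPeriod n := by
  obtain ⟨k, rfl⟩ := h
  rcases Nat.lt_or_ge k 2 with h2 | h2
  · obtain rfl : k = 1 := by omega
    exact exists_period_ten
  by_cases h5 : k % 5 = 3
  · have h10 : k % 10 = 3 ∨ k % 10 = 8 := by omega
    rcases h10 with h10 | h10
    · exact (treeTrajectories_long_one h10).exists_billiard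
    · exact (treeTrajectories_short_two h10).exists_billiard
  · exact (treeTrajectories_short_one h2 h5).exists_billiard

theorem mainTheorem11 :
    (∀ n : ℕ, 0 < n → 10 ∣ n →
      ∃ B : PentagonBilliards.BilliardTrajectory,
        B.RotationallySymmetric ∧ B.HasPeriod n) ∧
    (∀ k : ℕ, 2 ≤ k → k % 5 ≠ 3 →
      PentagonBilliards.TreeTrajectoriesSymmetricOfPeriod
        (1 :: List.replicate (k - 2) 0)
        PentagonBilliards.SurfaceTrajectory.IsShort (10 * k)) ∧
    (∀ k : ℕ, k % 10 = 3 →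
      PentagonBilliards.TreeTrajectoriesSymmetricOfPeriod
        (1 :: List.replicate ((k - 3) / 2) 0)
        PentagonBilliards.SurfaceTrajectory.IsLong (10 * k)) ∧
    (∀ k : ℕ, k % 10 = 8 →
      PentagonBilliards.TreeTrajectoriesSymmetricOfPeriod
        (2 :: List.replicate ((k - 2) / 2) 0)
        PentagonBilliards.SurfaceTrajectory.IsShort (10 * k)) :=
  ⟨fun _ hn h => exists_symmetric_of_ten_dvd hn h,
    fun _ hk h => PentagonBilliards.treeTrajectories_short_one hk h,
    fun _ h => PentagonBilliards.treeTrajectories_long_one h,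
    fun _ h => PentagonBilliards.treeTrajectories_short_two h⟩
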